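/- **Setting.** Consider Bernoulli site percolation on the nearest-neighbour lattice $\mathbb Z^d$ with parameter $p\in[0,1]$: under $\mathbb P_p$ every site belongs to the random set $\omega\subseteq\mathbb Z^d$ of occupied sites independently with probability $p$. Let $|x|=\sum_i|x_i|$ and $J(x)=\mathbf 1_{\{|x|=1\}}$. For a set $S$ of sites and $x\ne y$, say that $x$ and $y$ are connected in $S$ if there is a nearest-neighbour path from $x$ to $y$ all of whose inner vertices lie in $S$ (the end points need not lie in $S$); a site is never connected to itself. Write $\{x\leftrightarrow y\}$ for the event that $x,y$ are connected in $\omega$, and $\{x\leftrightarrow y \text{ off } A\}$ for the event that they are connected in $\omega\setminus A$. Let $\{x\Leftrightarrow y\}=\{x\leftrightarrow y\}\circ\{x\leftrightarrow y\}$, where $A\circ B$ is disjoint occurrence: $\omega\in A\circ B$ iff there are disjoint sets of sites $K,L$ such that every configuration agreeing with $\omega$ on $K$ lies in $A$ and every configuration agreeing with $\omega$ on $L$ lies in $B$. For $A\subseteq\mathbb Z^d$ let $\langle A\rangle$ be the union of $A$ and all its nearest neighbours, and put $$\{u\xrightarrow{A}x\}=\{u\leftrightarrow x\}\cap\big(\{u\leftrightarrow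 x\text{ off }\langle A\rangle\}^c\cup\{x\in\langle A\rangle\}\big).$$ Let $\mathrm{Piv}(v,u)$ be the random set of sites $y$ such that $v,u$ are connected in $\omega\cup\{y\}$ but not in $\omega\setminus\{y\}$, let $E'(v,u;A)=\{v\xrightarrow{A}u\}\cap\{\nexists\,u'\in\mathrm{Piv}(v,u):\ v\xrightarrow{A}u'\}$, and let $\widetilde{\mathscr C}^{u}(x;\omega)=\{x\}\cup\{y\in\omega\setminus\{u\}: x\leftrightarrow y\text{ off }\{u\}\}$. **Lace-expansion coefficients.** Let $\omega_0,\omega_1,\dots$ be independent configurations with law $\mathbb P_p$, and write $\mathbb P_p$ also for their joint law. Put $\Pi^{(0)}_p(x)=\mathbb P_p(\mathbf 0\Leftrightarrow x)-J(x)$ (which is nonnegative), and for $n\ge1$ $$\Pi^{(n)}_p(x)=p^n\sum_{u_0,\dots,u_{n-1}\in\mathbb Z^d}\mathbb P_p\Big(\{\mathbf 0\Leftrightarrow u_0\}\text{ occurs in }\omega_0\text{ and, for each } 1\le i\le n,\ E'(u_{i-1},u_i;\mathscr C_{i-1})\text{ occurs in }\omega_i\Big),$$ where $u_{-1}=\mathbf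 0$, $u_n=x$ and $\mathscr C_i=\widetilde{\mathscr C}^{u_i}(u_{i-1};\omega_i)$. **Triangles.** Let $\tau_p(x)=\mathbb P_p(\mathbf 0\leftrightarrow x)$, $\tau_p^\circ(x)=\mathbf 1_{\{x=\mathbf 0\}}+\tau_p(x)$, $\tau_p^\bullet(x)=\mathbf 1_{\{x=\mathbf 0\}}+p\,\tau_p(x)$, and $(f*g)(x)=\sum_y f(y)g(x-y)$. Define $$\triangle_p(x)=p^2(\tau_p*\tau_p*\tau_p)(x),\quad \triangle_p^\bullet(x)=p(\tau_p^\bullet*\tau_p*\tau_p)(x),\quad \triangle_p^{\bullet\circ}(x)=p(\tau_p^\bullet*\tau_p^\circ*\tau_p)(x),\quad \triangle_p^{\bullet\bullet\circ}(x)=(\tau_p^\bullet*\tau_p^\bullet*\tau_p^\circ)(x),$$ and $\triangle_p=\sup_{x}\triangle_p(x)$, $\triangle_p^{\bullet\circ}=\sup_{x\neq\mathbf 0}\triangle_p^{\bullet\circ}(x)$, $\triangle_p^{\bullet\bullet\circ}=\sup_x\triangle_p^{\bullet\bullet\circ}(x)$, and $$T_p=(1+\triangle_p)\,\triangle_p^{\bullet\circ}+\triangle_p\,\triangle_p^{\bullet\bullet\circ}.$$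 **Statement.** For every $d$, every $p\in[0,1]$ and every $n\ge0$, $$p\sum_{x\in\mathbb Z^d}\Pi_p^{(n)}(x)\ \le\ \triangle_p^\bullet(\mathbf 0)\,(T_p)^n,$$ where all sums, suprema and products are taken in $[0,\infty]$ (with $0\cdot\infty=0$). -/

import Mathlib

open MeasureTheory ProbabilityTheory
open scoped ENNReal unitInterval

namespace SitePerc

/-- The sites of the hypercubic lattice `ℤ^d`. -/
abbrev Site (d : ℕ) : Type := Fin d → ℤ

/-- The `1`-norm on `ℤ^d`. -/
def norm1 {d : ℕ} (x : Site d) : ℤ := ∑ i, |x i|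

/-- The nearest-neighbour graph of `ℤ^d`. -/
def lattice (d : ℕ) : SimpleGraph (Site d) where
  Adj x y := norm1 (y - x) = 1
  symm := ⟨fun x y h => by simpa only [norm1, Pi.sub_apply, abs_sub_comm] using h⟩
  loopless := ⟨fun x h => by simp [norm1] at h⟩

/-- A configuration, identified with its set of occupied sites. -/
abbrev Config (d : ℕ) : Type := Set (Site d)

/-- The site percolation measure: every site is occupied independently with probability `p`. -/
noncomputable def perc (d : ℕ) (p : I) : Measure (Config d) := setBernoulli Set.univ p

/-- The law of a sequence of independent site percolation configurations. -/
noncomputable def percSeq (d : ℕ) (p : I) : Measure (ℕ → Config d) :=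
  Measure.infinitePi fun _ : ℕ => setBernoulli (Set.univ : Set (Site d)) p

/-- The parameter `p` as an element of `[0,∞]`. -/
noncomputable def pE (p : I) : ℝ≥0∞ := (unitInterval.toNNReal p : ℝ≥0∞)

/-! ### Connections -/

/-- `x ≠ y`, and there is a nearest-neighbour path from `x` to `y` all of whose inner vertices
lie in `S` (the end points need not lie in `S`). -/
def ConnIn {d : ℕ} (S : Set (Site d)) (x y : Site d) : Prop :=
  x ≠ y ∧ ∃ w : (lattice d).Walk x y, ∀ i, 0 < i → i < w.length → w.getVert i ∈ S

/-- The event that `x` and `y` are connected. -/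
def conn {d : ℕ} (x y : Site d) : Set (Config d) := {ω | ConnIn ω x y}

/-- The event that `x` and `y` are connected by a path with all inner vertices in `ω \ A`. -/
def offConn {d : ℕ} (x y : Site d) (A : Set (Site d)) : Set (Config d) :=
  {ω | ConnIn (ω ∩ Aᶜ) x y}

/-- The cylinder event of the configurations that agree with `ω` on `K`. -/
def cyl {d : ℕ} (ω : Config d) (K : Set (Site d)) : Set (Config d) :=
  {ω' | ∀ x ∈ K, x ∈ ω' ↔ x ∈ ω}

/-- Disjoint occurrence `A ∘ B` of two events. -/
def disjOcc {d : ℕ} (A B : Set (Config d)) : Set (Config d) :=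
  {ω | ∃ K L : Set (Site d), Disjoint K L ∧ cyl ω K ⊆ A ∧ cyl ω L ⊆ B}

/-- The event that `x` and `y` are doubly connected. -/
def dblConn {d : ℕ} (x y : Site d) : Set (Config d) := disjOcc (conn x y) (conn x y)

/-- The pivotal sites of the (increasing) event `A` in the configuration `ω`. -/
def piv {d : ℕ} (A : Set (Config d)) (ω : Config d) : Set (Site d) :=
  {y | ω ∪ {y} ∈ A ∧ ω \ {y} ∉ A}

/-- The modified cluster of `x` with designated vertex `u`: the site `x` together with the occupied
sites `y ≠ u` that are connected to `x` in `ℤ^d \ {u}`. -/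
def modCluster {d : ℕ} (u x : Site d) (ω : Config d) : Set (Site d) :=
  {x} ∪ {y | y ∈ ω \ {u} ∧ ω ∈ offConn x y {u}}

/-- The set `⟨A⟩`, consisting of `A` and its external boundary. -/
def thick {d : ℕ} (A : Set (Site d)) : Set (Site d) :=
  A ∪ {y | ∃ x ∈ A, norm1 (x - y) = 1}

/-- The event that `x` is connected to `y` through `A`: `x` is connected to `y`, and either `x` is
not connected to `y` off `⟨A⟩`, or `y ∈ ⟨A⟩`. -/
def throughConn {d : ℕ} (A : Set (Site d)) (x y : Site d) : Set (Config d) :=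
  conn x y ∩ ((offConn x y (thick A))ᶜ ∪ {_ω | y ∈ thick A})

/-- The event `E'(v,u;A)`. -/
def eventE' {d : ℕ} (v u : Site d) (A : Set (Site d)) : Set (Config d) :=
  throughConn A v u ∩ {ω | ¬ ∃ u' ∈ piv (conn v u) ω, ω ∈ throughConn A v u'}

/-! ### Lace-expansion coefficients -/

/-- `J(x) = 1_{|x| = 1}`. -/
noncomputable def J {d : ℕ} (x : Site d) : ℝ≥0∞ := if norm1 x = 1 then 1 else 0

/-- The sequence `u_{-1} = 0, u_0, …, u_{m-1}, u_m = x`, with indices shifted by one: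
`vtx u x k = u_{k-1}`. -/
def vtx {d m : ℕ} (u : Fin m → Site d) (x : Site d) : ℕ → Site d
  | 0 => 0
  | k + 1 => if h : k < m then u ⟨k, h⟩ else x

/-- The event on the sequence `ω_0, ω_1, …` that `0` and `u_0` are doubly connected in `ω_0` and
that `E'(u_{i-1}, u_i; C_{i-1})` occurs in `ω_i` for `i = 1, …, m`, where `C_j` is the modified
cluster of `u_{j-1}` with designated vertex `u_j` in `ω_j`. Here `i = j + 1`. -/
def laceEvent {d m : ℕ} (u : Fin m → Site d) (x : Site d) : Set (ℕ → Config d) :=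
  {ω | ω 0 ∈ dblConn 0 (vtx u x 1) ∧
    ∀ j < m, ω (j + 1) ∈ eventE' (vtx u x (j + 1)) (vtx u x (j + 2))
      (modCluster (vtx u x (j + 1)) (vtx u x j) (ω j))}

/-- The lace-expansion coefficient `Π_p^{(n)}(x)`, with values in `[0,∞]`. The subtraction for
`n = 0` is never truncated, see `J_le_perc_dblConn`. -/
noncomputable def lacePi {d : ℕ} (p : I) : ℕ → Site d → ℝ≥0∞
  | 0, x => perc d p (dblConn 0 x) - J x
  | m + 1, x => pE p ^ (m + 1) * ∑' u : Fin (m + 1) → Site d, percSeq d p (laceEvent u x)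

/-- Neighbours are always doubly connected. -/
theorem J_le_perc_dblConn {d : ℕ} (p : I) (x : Site d) : J x ≤ perc d p (dblConn 0 x) := by
  by_cases h : norm1 x = 1
  · have hadj : (lattice d).Adj 0 x := by simpa [lattice] using h
    have hc : conn 0 x = Set.univ := by
      refine Set.eq_univ_of_forall fun ω => ⟨hadj.ne, hadj.toWalk, fun i h0 h1 => ?_⟩
      simp at h1
      omega
    have hd : dblConn 0 x = Set.univ := by
      refine Set.eq_univ_of_forall fun ω => ⟨∅, ∅, by simp, ?_, ?_⟩ <;> simp [hc]
    rw [hd, perc]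
    simp [J, h]
  · simp [J, h]

/-! ### Two-point functions and triangles, with values in `[0,∞]` -/

/-- The two-point function. -/
noncomputable def tau {d : ℕ} (p : I) (x : Site d) : ℝ≥0∞ := perc d p (conn 0 x)

/-- `τ_p^∘ = δ_0 + τ_p`. -/
noncomputable def tauO {d : ℕ} (p : I) (x : Site d) : ℝ≥0∞ :=
  (if x = 0 then 1 else 0) + tau p x

/-- `τ_p^• = δ_0 + p τ_p`. -/
noncomputable def tauB {d : ℕ} (p : I) (x : Site d) : ℝ≥0∞ :=
  (if x = 0 then 1 else 0) + pE p * tau p x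

/-- Convolution on `ℤ^d`. -/
noncomputable def conv {d : ℕ} (f g : Site d → ℝ≥0∞) (x : Site d) : ℝ≥0∞ :=
  ∑' y, f y * g (x - y)

/-- The open triangle `△_p(x)`. -/
noncomputable def tri {d : ℕ} (p : I) (x : Site d) : ℝ≥0∞ :=
  pE p ^ 2 * conv (conv (tau p) (tau p)) (tau p) x

/-- `△_p^•(x)`. -/
noncomputable def triB {d : ℕ} (p : I) (x : Site d) : ℝ≥0∞ :=
  pE p * conv (conv (tauB p) (tau p)) (tau p) x

/-- `△_p^{•∘}(x)`. -/
noncomputable def triBO {d : ℕ} (p : I) (x : Site d) : ℝ≥0∞ :=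
  pE p * conv (conv (tauB p) (tauO p)) (tau p) x

/-- `△_p^{••∘}(x)`. -/
noncomputable def triBBO {d : ℕ} (p : I) (x : Site d) : ℝ≥0∞ :=
  conv (conv (tauB p) (tauB p)) (tauO p) x

/-- `△_p`, the supremum over all sites. -/
noncomputable def triSup (d : ℕ) (p : I) : ℝ≥0∞ := ⨆ x : Site d, tri p x

/-- `△_p^{•∘}`, the supremum over all sites other than the origin. -/
noncomputable def triBOSup (d : ℕ) (p : I) : ℝ≥0∞ := ⨆ (x : Site d) (_ : x ≠ 0), triBO p x

/-- `△_p^{••∘}`, the supremum over all sites. -/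
noncomputable def triBBOSup (d : ℕ) (p : I) : ℝ≥0∞ := ⨆ x : Site d, triBBO p x

/-- `T_p = (1 + △_p) △_p^{•∘} + △_p △_p^{••∘}`. -/
noncomputable def T (d : ℕ) (p : I) : ℝ≥0∞ :=
  (1 + triSup d p) * triBOSup d p + triSup d p * triBBOSup d p

end SitePerc

/-! The proof extracts disjoint paths from each configuration, bounds their probabilities by the van
den Berg–Kesten inequality, and iterates, integrating out one configuration at a time.

Consider `E'(v,u;A)` together with `b ∈ ⟨C⟩`, where `C` is the modified cluster of `v`. If `u ∉
⟨A⟩`, let `y` be the last pivotal site, or `v` if there is none. No site separates `y` from `u`, so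
Menger's theorem gives two disjoint paths from `y` to `u`, and the definition of `E'` forces both
through `⟨A⟩` (`exists_sausage`). A path from `v` to `b`, cut at its last visit to this backbone,
leaves it at a site `t ≠ u`. This yields the disjoint connections of
`exists_diagram_of_mem_eventE'`, in which `z` is a site of `⟨A⟩` on the backbone. By
`setBernoulli_up_box_le` the probability is at most a sum over `z ∈ ⟨A⟩` of products of two-point
functions.

The set `A` enters this bound only through the indicators of `z ∈ ⟨A⟩`. When `A` is the cluster of
the previous configuration, integrating over that configuration turns them into events of the same
type with `b = z` (`lintegral_chainSum_le`, `chainSum_le`). Summed over its sites, each step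
contributes at most `T` (`tsum_phi_le`): the case `u ∈ ⟨A⟩` gives `△^{•∘}`, a branch point before
the sausage gives `△ △^{••∘}`, and one on it gives `△ △^{•∘}`. The double connection in the first
configuration contributes `△^•(0)`. -/

namespace SitePerc

/-! ### The van den Berg–Kesten inequality on a countable set of sites -/

section BK

variable {ι κ : Type*}

/-- The event that every site of `K` is occupied. -/
def occ (K : Finset ι) : Set (Set ι) := {ω | (K : Set ι) ⊆ ω}

/-- The increasing event generated by a family of finite sets of sites. -/
def up (𝒜 : Set (Finset ι)) : Set (Set ι) := {ω | ∃ K ∈ 𝒜, (K : Set ι) ⊆ ω}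

theorem measurableSet_occ (K : Finset ι) : MeasurableSet (occ K) := by
  have : occ K = ⋂ x ∈ K, {ω : Set ι | x ∈ ω} := by
    ext ω; simp [occ, Set.subset_def]
  rw [this]
  exact K.measurableSet_biInter fun x _ => measurableSet_setOfPred.2 (measurable_set_mem x)

theorem measurableSet_up [Countable ι] (𝒜 : Set (Finset ι)) : MeasurableSet (up 𝒜) := by
  have : up 𝒜 = ⋃ K ∈ 𝒜, occ K := by
    ext ω; simp [occ, up]
  rw [this]
  exact MeasurableSet.biUnion 𝒜.to_countable fun K _ => measurableSet_occ K

theorem up_mono {𝒜 ℬ : Set (Finset ι)} (h : 𝒜 ⊆ ℬ) : up 𝒜 ⊆ up ℬ :=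
  fun _ ⟨K, hK, hω⟩ => ⟨K, h hK, hω⟩

theorem setBernoulli_occ (p : I) (K : Finset ι) :
    setBernoulli (Set.univ : Set ι) p (occ K) = pE p ^ K.card := by
  have : ((fun q : ι → Prop => {i | q i}) ⁻¹' occ K) = Set.pi K (fun _ => {True}) := by
    ext q; simp [occ, Set.subset_def]
  rw [setBernoulli_apply', this, Measure.infinitePi_pi]
  · simp [pE, Finset.prod_const]
  · simp

/-- A probability measure on configurations is determined by the probabilities that finite sets of
sites are occupied. -/
theorem eq_setBernoulli (p : I) (ν : Measure (Set ι)) [IsProbabilityMeasure ν]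
    (h : ∀ K : Finset ι, ν (occ K) = pE p ^ K.card) :
    ν = setBernoulli (Set.univ : Set ι) p := by
  classical
  refine ext_of_generate_finite (Set.range (occ : Finset ι → Set (Set ι))) ?_ ?_ ?_ (by simp)
  · apply le_antisymm
    · have : @Measurable _ _ (MeasurableSpace.generateFrom (Set.range (occ : Finset ι → _))) _
          (id : Set ι → Set ι) := by
        refine (@measurable_set_iff _ _ (_) _).2 fun a => ?_
        refine (@measurableSet_setOfPred _ (_) _).1 ?_
        refine MeasurableSpace.measurableSet_generateFrom ⟨{a}, ?_⟩
        ext ω; simp [occ]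
      simpa [measurable_iff_comap_le] using this
    · refine MeasurableSpace.generateFrom_le ?_
      rintro _ ⟨K, rfl⟩
      exact measurableSet_occ K
  · rintro _ ⟨K, rfl⟩ _ ⟨L, rfl⟩ -
    exact ⟨K ∪ L, by ext ω; simp [occ]⟩
  · rintro _ ⟨K, rfl⟩
    rw [h, setBernoulli_occ]

theorem measurable_preimage_config (f : κ → ι) : Measurable (fun ω : Set ι => f ⁻¹' ω) :=
  measurable_set_iff.2 fun a => measurable_set_mem (f a)

theorem setBernoulli_map_preimage (p : I) (f : κ → ι) (hf : Function.Injective f) :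
    (setBernoulli (Set.univ : Set ι) p).map (fun ω => f ⁻¹' ω) = setBernoulli Set.univ p := by
  have hm := measurable_preimage_config f
  have := Measure.isProbabilityMeasure_map (μ := setBernoulli (Set.univ : Set ι) p) hm.aemeasurable
  refine eq_setBernoulli p _ fun K => ?_
  rw [Measure.map_apply hm (measurableSet_occ K)]
  have : (fun ω : Set ι => f ⁻¹' ω) ⁻¹' occ K = occ (K.map ⟨f, hf⟩) := by
    ext ω; simp [occ]
  rw [this, setBernoulli_occ, Finset.card_map]

/-- The configuration on a disjoint union given by configurations on its two parts. -/
def sumConfig (q : Set ι × Set κ) : Set (ι ⊕ κ) := {s | Sum.elim (· ∈ q.1) (· ∈ q.2) s}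

theorem setBernoulli_map_sum (p : I) :
    ((setBernoulli (Set.univ : Set ι) p).prod (setBernoulli (Set.univ : Set κ) p)).map
      sumConfig = setBernoulli Set.univ p := by
  have hm : Measurable (sumConfig (ι := ι) (κ := κ)) := by
    refine measurable_set_iff.2 ?_
    rintro (a | a)
    · exact (measurable_set_mem a).comp measurable_fst
    · exact (measurable_set_mem a).comp measurable_snd
  have := Measure.isProbabilityMeasure_map
    (μ := (setBernoulli (Set.univ : Set ι) p).prod (setBernoulli (Set.univ : Set κ) p))
    hm.aemeasurable
  refine eq_setBernoulli p _ fun K => ?_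
  rw [Measure.map_apply hm (measurableSet_occ K)]
  have : sumConfig (ι := ι) (κ := κ) ⁻¹' occ K
      = occ K.toLeft ×ˢ occ K.toRight := by
    ext ω
    simp only [occ, Set.mem_preimage, Set.mem_ofPred_eq, Set.subset_def, Set.mem_prod]
    constructor
    · intro h
      exact ⟨fun x hx => h (Sum.inl x) (by simpa using hx),
        fun x hx => h (Sum.inr x) (by simpa using hx)⟩
    · rintro ⟨h1, h2⟩ (x | x) hx
      · exact h1 x (by simpa using hx)
      · exact h2 x (by simpa using hx)
  rw [this, Measure.prod_prod, setBernoulli_occ, setBernoulli_occ, ← pow_add,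
    Finset.card_toLeft_add_card_toRight]

variable [DecidableEq ι]

/-- If `𝒢` arises from `ℋ` by replacing, in some of its members, the site `e` by a fresh site `f`,
then the increasing event generated by `𝒢` is at least as likely as the one generated by `ℋ`. -/
theorem setBernoulli_up_le_of_replace [Countable ι] (p : I) {e f : ι} {ℋ 𝒢 : Set (Finset ι)}
    (hf : ∀ H ∈ ℋ, f ∉ H) (h0 : ∀ H ∈ ℋ, e ∉ H → H ∈ 𝒢)
    (h1 : ∀ H ∈ ℋ, e ∈ H → H ∈ 𝒢 ∨ insert f (H.erase e) ∈ 𝒢) :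
    setBernoulli (Set.univ : Set ι) p (up ℋ) ≤ setBernoulli Set.univ p (up 𝒢) := by
  set μ := setBernoulli (Set.univ : Set ι) p
  set swp : Set ι → Set ι := fun ω => (Equiv.swap e f) ⁻¹' ω
  have hswp : MeasurePreserving swp μ μ :=
    ⟨measurable_preimage_config _, setBernoulli_map_preimage p _ (Equiv.swap e f).injective⟩
  -- The inequality is proved separately on and off the event `up 𝒞` that some replaceable member is
  -- occupied except possibly at `e`. This event does not involve `e` or `f`, so it is invariant
  -- under swapping them.
  set 𝒞 : Set (Finset ι) := {K | ∃ H ∈ ℋ, e ∈ H ∧ insert f (H.erase e) ∈ 𝒢 ∧ K = H.erase e}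
  have hC : MeasurableSet (up 𝒞) := measurableSet_up _
  have hfix : ∀ (ω : Set ι) (x : ι), x ≠ e → x ≠ f → (x ∈ swp ω ↔ x ∈ ω) := by
    intro ω x hx hx'
    simp [swp, Equiv.swap_apply_of_ne_of_ne hx hx']
  rw [← measure_inter_add_sdiff (up ℋ) hC, ← measure_inter_add_sdiff (up 𝒢) hC]
  refine add_le_add ?_ (measure_mono ?_)
  · rw [← hswp.measure_preimage ((measurableSet_up 𝒢).inter hC).nullMeasurableSet]
    refine measure_mono ?_
    rintro ω ⟨⟨H, hH, hHω⟩, K, ⟨H', hH', he, hg, rfl⟩, hKω⟩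
    have hK' : ((H'.erase e : Finset ι) : Set ι) ⊆ swp ω := by
      intro x hx
      have hx' : x ≠ e ∧ x ∈ H' := Finset.mem_erase.1 hx
      exact (hfix ω x hx'.1 (fun h => hf _ hH' (h ▸ hx'.2))).2 (hKω hx)
    refine ⟨?_, _, ⟨H', hH', he, hg, rfl⟩, hK'⟩
    -- After the swap `f` is occupied if `e` was, which completes the replaced set. Otherwise `H`
    -- contains neither `e` nor `f`, so the swap does not touch it.
    by_cases heω : e ∈ ω
    · refine ⟨_, hg, ?_⟩
      rw [Finset.coe_insert, Set.insert_subset_iff]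
      exact ⟨by simpa [swp] using heω, hK'⟩
    · have heH : e ∉ H := fun h => heω (hHω h)
      refine ⟨H, h0 H hH heH, fun x hx => ?_⟩
      exact (hfix ω x (fun h => heH (h ▸ hx)) (fun h => hf _ hH (h ▸ hx))).2 (hHω hx)
  · rintro ω ⟨⟨H, hH, hHω⟩, hn⟩
    refine ⟨⟨H, ?_, hHω⟩, hn⟩
    by_cases he : e ∈ H
    · refine (h1 H hH he).resolve_right fun hg => hn ⟨_, ⟨H, hH, he, hg, rfl⟩, fun x hx => hHω ?_⟩
      exact Finset.mem_of_mem_erase hx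
    · exact h0 H hH he

/-- The family generating the disjoint occurrence of `up 𝒜` and `up ℬ`. -/
def box (𝒜 ℬ : Set (Finset ι)) : Set (Finset ι) :=
  {H | ∃ K ∈ 𝒜, ∃ L ∈ ℬ, Disjoint K L ∧ H = K ∪ L}

/-- The interpolation between disjoint occurrence in one configuration and occurrence in two
independent ones: on `S` the second event uses its own copy of the configuration. -/
def splitBox (S : Finset ι) (𝒜 ℬ : Set (Finset ι)) : Set (Finset (ι ⊕ ι)) :=
  {H | ∃ K ∈ 𝒜, ∃ L ∈ ℬ, Disjoint (K \ S) (L \ S) ∧ H = (K ∪ L \ S).disjSum (L ∩ S)}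

theorem setBernoulli_up_splitBox_le [Countable ι] (p : I) (𝒜 ℬ : Set (Finset ι)) (S : Finset ι) :
    setBernoulli Set.univ p (up (splitBox ∅ 𝒜 ℬ)) ≤
      setBernoulli Set.univ p (up (splitBox S 𝒜 ℬ)) := by
  induction S using Finset.induction_on with
  | empty => exact le_rfl
  | insert e S he ih =>
    refine ih.trans ?_
    refine setBernoulli_up_le_of_replace p (e := Sum.inl e) (f := Sum.inr e) ?_ ?_ ?_
    · rintro _ ⟨K, hK, L, hL, hd, rfl⟩
      simp [he]
    all_goals
      rintro _ ⟨K, hK, L, hL, hd, rfl⟩ hn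
      have hd' : Disjoint (K \ insert e S) (L \ insert e S) :=
        hd.mono (by gcongr; simp) (by gcongr; simp)
      -- At most one of `K` and `L` uses `e`, so moving the use of `e` by `L` to the second copy
      -- takes nothing from `K`.
      have hde : e ∈ K → e ∉ L := fun h1 h2 =>
        Finset.disjoint_left.1 hd (Finset.mem_sdiff.2 ⟨h1, he⟩) (Finset.mem_sdiff.2 ⟨h2, he⟩)
    · refine ⟨K, hK, L, hL, hd', ?_⟩
      ext (x | x) <;> simp at hn ⊢ <;> grind
    · by_cases heL : e ∈ L
      · right
        refine ⟨K, hK, L, hL, hd', ?_⟩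
        ext (x | x) <;> simp at hn ⊢ <;> grind
      · left
        refine ⟨K, hK, L, hL, hd', ?_⟩
        ext (x | x) <;> simp at hn ⊢ <;> grind

theorem setBernoulli_up_box_le_of_subset [Countable ι] (p : I) {𝒜 ℬ : Set (Finset ι)} (S : Finset ι)
    (hℬ : ∀ L ∈ ℬ, L ⊆ S) :
    setBernoulli Set.univ p (up (box 𝒜 ℬ)) ≤
      setBernoulli Set.univ p (up 𝒜) * setBernoulli Set.univ p (up ℬ) := by
  have h1 : setBernoulli Set.univ p (up (box 𝒜 ℬ)) ≤
      setBernoulli Set.univ p (up (splitBox ∅ 𝒜 ℬ)) := by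
    rw [← setBernoulli_map_preimage p (Sum.inl : ι → ι ⊕ ι) Sum.inl_injective,
      Measure.map_apply (measurable_preimage_config _) (measurableSet_up _)]
    refine measure_mono ?_
    rintro ω ⟨_, ⟨K, hK, L, hL, hd, rfl⟩, hω⟩
    refine ⟨_, ⟨K, hK, L, hL, by simpa using hd, rfl⟩, ?_⟩
    rintro (x | x) hx
    · exact hω (by simpa using hx)
    · simp at hx
  refine h1.trans ((setBernoulli_up_splitBox_le p 𝒜 ℬ S).trans ?_)
  rw [← Measure.prod_prod, ← setBernoulli_map_sum, Measure.map_apply_of_aemeasurable]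
  · refine measure_mono ?_
    rintro ⟨ω, ω'⟩ ⟨_, ⟨K, hK, L, hL, hd, rfl⟩, hω⟩
    refine ⟨⟨K, hK, fun x hx => ?_⟩, ⟨L, hL, fun x hx => ?_⟩⟩
    · have hx' : x ∈ K := hx
      have := @hω (Sum.inl x) (by simp [hx'])
      exact this
    · have hx' : x ∈ L := hx
      have := @hω (Sum.inr x) (by simp [hx', hℬ L hL hx'])
      exact this
  -- The map of a measure under a function that is not a.e. measurable is `0`, whereas this one is a
  -- probability measure.
  · by_contra hn
    have h := setBernoulli_map_sum (ι := ι) (κ := ι) p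
    rw [Measure.map_of_not_aemeasurable hn] at h
    simpa using congrArg (fun μ => μ Set.univ) h
  · exact measurableSet_up _

/-- The van den Berg–Kesten inequality for increasing events generated by finite sets. -/
theorem setBernoulli_up_box_le [Countable ι] (p : I) (𝒜 ℬ : Set (Finset ι)) :
    setBernoulli Set.univ p (up (box 𝒜 ℬ)) ≤
      setBernoulli Set.univ p (up 𝒜) * setBernoulli Set.univ p (up ℬ) := by
  have h : up (box 𝒜 ℬ) = ⋃ S : Finset ι, up (box 𝒜 {L ∈ ℬ | L ⊆ S}) := by
    ext ω
    simp only [Set.mem_iUnion]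
    constructor
    · rintro ⟨_, ⟨K, hK, L, hL, hd, rfl⟩, hω⟩
      exact ⟨L, _, ⟨K, hK, L, ⟨hL, subset_rfl⟩, hd, rfl⟩, hω⟩
    · rintro ⟨S, _, ⟨K, hK, L, hL, hd, rfl⟩, hω⟩
      exact ⟨_, ⟨K, hK, L, hL.1, hd, rfl⟩, hω⟩
  have hdir : Directed (· ⊆ ·) fun S : Finset ι => up (box 𝒜 {L ∈ ℬ | L ⊆ S}) := by
    refine Monotone.directed_le fun S T hST => up_mono ?_
    rintro _ ⟨K, hK, L, hL, hd, rfl⟩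
    exact ⟨K, hK, L, ⟨hL.1, hL.2.trans hST⟩, hd, rfl⟩
  rw [h, hdir.measure_iUnion]
  refine iSup_le fun S => (setBernoulli_up_box_le_of_subset p S fun L hL => hL.2).trans ?_
  gcongr
  exact up_mono fun L hL => hL.1

end BK

/-! ### Self-avoiding paths and Menger's theorem for two paths -/

section Paths

variable {d : ℕ} {x y z v u t b : Site d} {S S' : Set (Site d)} {l l₁ l₂ : List (Site d)}

/-- There is a nearest-neighbour path from `x` to `y` with list of inner vertices `l`. -/
def PathVia : Site d → List (Site d) → Site d → Prop
  | x, [], y => (lattice d).Adj x y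
  | x, s :: l, y => (lattice d).Adj x s ∧ PathVia s l y

theorem pathVia_append : PathVia x (l₁ ++ z :: l₂) y ↔ PathVia x l₁ z ∧ PathVia z l₂ y := by
  induction l₁ generalizing x with
  | nil => simp [PathVia]
  | cons s l ih => simp [PathVia, ih, and_assoc]

theorem PathVia.concat (h : PathVia x l z) (hz : (lattice d).Adj z y) :
    PathVia x (l ++ [z]) y :=
  pathVia_append.2 ⟨h, hz⟩

theorem PathVia.exists_walk (h : PathVia x l y) : ∃ w : (lattice d).Walk x y, 0 < w.length ∧
    ∀ i, 0 < i → i < w.length → w.getVert i ∈ l := by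
  induction l generalizing x with
  | nil =>
    have h' : (lattice d).Adj x y := h
    refine ⟨h'.toWalk, by simp, fun i h0 h1 => ?_⟩
    simp at h1; omega
  | cons s l ih =>
    obtain ⟨w, -, hw⟩ := ih h.2
    refine ⟨.cons h.1 w, by simp, fun i h0 h1 => ?_⟩
    obtain ⟨j, rfl⟩ : ∃ j, i = j + 1 := ⟨i - 1, by omega⟩
    rw [SimpleGraph.Walk.getVert_cons_succ]
    rcases Nat.eq_zero_or_pos j with rfl | hj
    · simp
    · exact List.mem_cons_of_mem _ (hw j hj (by simpa using h1))

theorem exists_pathVia_of_walk (w : (lattice d).Walk x y) (hw : 0 < w.length) :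
    ∃ l, PathVia x l y ∧ ∀ s ∈ l, ∃ i, 0 < i ∧ i < w.length ∧ w.getVert i = s := by
  induction w with
  | nil => simp at hw
  | @cons x s y h w ih =>
    rcases Nat.eq_zero_or_pos w.length with h0 | h0
    · obtain rfl := SimpleGraph.Walk.eq_of_length_eq_zero h0
      exact ⟨[], h, by simp⟩
    · obtain ⟨l, hl, hl'⟩ := ih h0
      refine ⟨s :: l, ⟨h, hl⟩, fun a ha => ?_⟩
      rcases List.mem_cons.1 ha with rfl | ha
      · exact ⟨1, by simp, by simpa using h0, by simp⟩
      · obtain ⟨i, hi, hi', rfl⟩ := hl' a ha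
        exact ⟨i + 1, by simp, by simpa using hi', by simp⟩

theorem connIn_iff : ConnIn S x y ↔ x ≠ y ∧ ∃ l, PathVia x l y ∧ ∀ s ∈ l, s ∈ S := by
  refine and_congr_right fun hne => ⟨?_, ?_⟩
  · rintro ⟨w, hw⟩
    have h0 : 0 < w.length := by
      rcases Nat.eq_zero_or_pos w.length with h0 | h0
      · exact absurd (SimpleGraph.Walk.eq_of_length_eq_zero h0) hne
      · exact h0
    obtain ⟨l, hl, hl'⟩ := exists_pathVia_of_walk w h0
    refine ⟨l, hl, fun s hs => ?_⟩
    obtain ⟨i, hi, hi', rfl⟩ := hl' s hs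
    exact hw i hi hi'
  · rintro ⟨l, hl, hS⟩
    obtain ⟨w, -, hw⟩ := hl.exists_walk
    exact ⟨w, fun i h0 h1 => hS _ (hw i h0 h1)⟩

theorem PathVia.connIn (h : PathVia x l y) (hne : x ≠ y) (hS : ∀ s ∈ l, s ∈ S) : ConnIn S x y :=
  connIn_iff.2 ⟨hne, l, h, hS⟩

theorem ConnIn.mono (h : ConnIn S x y) (hS : S ⊆ S') : ConnIn S' x y := by
  obtain ⟨hne, l, hl, hl'⟩ := connIn_iff.1 h
  exact hl.connIn hne fun s hs => hS (hl' s hs)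

theorem PathVia.reverse (h : PathVia x l y) : PathVia y l.reverse x := by
  induction l generalizing x with
  | nil => exact SimpleGraph.Adj.symm h
  | cons s l ih =>
    rw [List.reverse_cons]
    exact (ih h.2).concat h.1.symm

theorem ConnIn.symm (h : ConnIn S x y) : ConnIn S y x := by
  obtain ⟨hne, l, hl, hl'⟩ := connIn_iff.1 h
  exact hl.reverse.connIn hne.symm fun s hs => hl' s (List.mem_reverse.1 hs)

theorem ConnIn.trans (h : ConnIn S x y) (hy : y ∈ S) (h' : ConnIn S y z) (hne : x ≠ z) :
    ConnIn S x z := by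
  obtain ⟨-, l, hl, hS⟩ := connIn_iff.1 h
  obtain ⟨-, l', hl', hS'⟩ := connIn_iff.1 h'
  refine (pathVia_append.2 ⟨hl, hl'⟩).connIn hne fun s hs => ?_
  simp only [List.mem_append, List.mem_cons] at hs
  rcases hs with hs | rfl | hs
  · exact hS s hs
  · exact hy
  · exact hS' s hs

/-- `l` lists the inner vertices of a self-avoiding path from `x` to `y`. -/
structure SPath (x : Site d) (l : List (Site d)) (y : Site d) : Prop where
  path : PathVia x l y
  nodup : l.Nodup
  left : x ∉ l
  right : y ∉ l
  ne : x ≠ y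

theorem PathVia.exists_spath (h : PathVia x l y) (hne : x ≠ y) :
    ∃ l', SPath x l' y ∧ ∀ s ∈ l', s ∈ l := by
  induction l generalizing x with
  | nil => exact ⟨[], ⟨h, by simp, by simp, by simp, hne⟩, by simp⟩
  | cons s l ih =>
    by_cases hs : s = y
    · subst hs
      exact ⟨[], ⟨h.1, by simp, by simp, by simp, hne⟩, by simp⟩
    obtain ⟨l', hl', hsub⟩ := ih h.2 hs
    by_cases hx : x ∈ l'
    · obtain ⟨a, c, rfl⟩ := List.append_of_mem hx
      have hn := hl'.nodup
      have hr := hl'.right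
      refine ⟨c, ⟨(pathVia_append.1 hl'.path).2, ?_, ?_, ?_, hne⟩, ?_⟩ <;> grind
    · by_cases hxs : x = s
      · subst hxs
        exact ⟨l', hl', fun a ha => List.mem_cons_of_mem _ (hsub a ha)⟩
      · refine ⟨s :: l', ⟨⟨h.1, hl'.path⟩, ?_, ?_, ?_, hne⟩, ?_⟩
        · exact List.nodup_cons.2 ⟨hl'.left, hl'.nodup⟩
        · simp [hxs, hx]
        · simp [Ne.symm hs, hl'.right]
        · intro a ha
          rcases List.mem_cons.1 ha with rfl | ha
          · simp
          · exact List.mem_cons_of_mem _ (hsub a ha)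

theorem ConnIn.exists_spath (h : ConnIn S x y) : ∃ l, SPath x l y ∧ ∀ s ∈ l, s ∈ S := by
  obtain ⟨hne, l, hl, hl'⟩ := connIn_iff.1 h
  obtain ⟨l', h1, h2⟩ := hl.exists_spath hne
  exact ⟨l', h1, fun s hs => hl' s (h2 s hs)⟩

theorem SPath.connIn (h : SPath x l y) (hS : ∀ s ∈ l, s ∈ S) : ConnIn S x y :=
  h.path.connIn h.ne hS

/-- Either `y = x` and `l` is empty, or `l` lists the vertices other than `x` of a self-avoiding
path from `x` to `y`. -/
def Arm (x : Site d) (l : List (Site d)) (y : Site d) : Prop :=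
  (x = y ∧ l = []) ∨ ∃ l', l = l' ++ [y] ∧ SPath x l' y

theorem SPath.split (h : SPath x l y) (ht : t ∈ l) : ∃ l₁ l₂, l = l₁ ++ t :: l₂ ∧
    SPath x l₁ t ∧ SPath t l₂ y := by
  obtain ⟨a, c, rfl⟩ := List.append_of_mem ht
  obtain ⟨h1, h2, h3, h4, h5⟩ := h
  obtain ⟨h1, h1'⟩ := pathVia_append.1 h1
  exact ⟨a, c, rfl, ⟨h1, by grind, by grind, by grind, by grind⟩,
    ⟨h1', by grind, by grind, by grind, by grind⟩⟩

theorem SPath.exists_arm (h : SPath x l y) (ht : t = x ∨ t ∈ l) : ∃ l₁ l₂, l = l₁ ++ l₂ ∧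
    Arm x l₁ t ∧ SPath t l₂ y := by
  rcases ht with rfl | ht
  · exact ⟨[], l, rfl, Or.inl ⟨rfl, rfl⟩, h⟩
  · obtain ⟨l₁, l₂, rfl, h1, h2⟩ := h.split ht
    exact ⟨l₁ ++ [t], l₂, by simp, Or.inr ⟨l₁, rfl, h1⟩, h2⟩

theorem Arm.split (h : Arm x l y) (ht : t = x ∨ t ∈ l) : ∃ l₁ l₂, l = l₁ ++ l₂ ∧
    Arm x l₁ t ∧ Arm t l₂ y := by
  rcases ht with rfl | ht
  · exact ⟨[], l, rfl, Or.inl ⟨rfl, rfl⟩, h⟩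
  rcases h with ⟨rfl, rfl⟩ | ⟨l', rfl, h⟩
  · simp at ht
  rcases List.mem_append.1 ht with ht | ht
  · obtain ⟨l₁, l₂, rfl, h1, h2⟩ := h.split ht
    exact ⟨l₁ ++ [t], l₂ ++ [y], by simp, Or.inr ⟨l₁, rfl, h1⟩, Or.inr ⟨l₂, rfl, h2⟩⟩
  · obtain rfl := List.mem_singleton.1 ht
    exact ⟨l' ++ [t], [], by simp, Or.inr ⟨l', rfl, h⟩, Or.inl ⟨rfl, rfl⟩⟩

theorem Arm.nodup (h : Arm x l y) : l.Nodup := by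
  rcases h with ⟨rfl, rfl⟩ | ⟨l', rfl, h⟩
  · simp
  · have := h.nodup
    have := h.right
    grind

/-- A path that starts in `Γ` can be cut at its last visit to `Γ`. -/
theorem PathVia.exists_last_visit (Γ : Set (Site d)) (h : PathVia x l y) (hx : x ∈ Γ) :
    ∃ t ∈ Γ, ∃ l', PathVia t l' y ∧ (∀ s ∈ l', s ∈ l) ∧ ∀ s ∈ l', s ∉ Γ := by
  suffices H : (∀ s ∈ l, s ∉ Γ) ∨
      ∃ t ∈ Γ, ∃ l', PathVia t l' y ∧ (∀ s ∈ l', s ∈ l) ∧ ∀ s ∈ l', s ∉ Γ by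
    rcases H with H | H
    · exact ⟨x, hx, l, h, fun s hs => hs, H⟩
    · exact H
  clear hx
  induction l generalizing x with
  | nil => simp
  | cons s l ih =>
    rcases ih h.2 with H | ⟨t, ht, l', h1, h2, h3⟩
    · by_cases hs : s ∈ Γ
      · exact Or.inr ⟨s, hs, l, h.2, fun a ha => List.mem_cons_of_mem _ ha, H⟩
      · left
        intro a ha
        rcases List.mem_cons.1 ha with rfl | ha
        · exact hs
        · exact H a ha
    · exact Or.inr ⟨t, ht, l', h1, fun a ha => List.mem_cons_of_mem _ (h2 a ha), h3⟩

/-- Extending one of two disjoint paths from `y` to `w` by a path that leaves it at `t`. -/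
theorem exists_disjoint_spath_of_branch {w : Site d} {K L Q : List (Site d)} (hK : SPath y K w)
    (hL : SPath y L w) (hKL : ∀ s ∈ K, s ∉ L) (hx : (lattice d).Adj w x) (hyx : y ≠ x)
    (ht : t = y ∨ t ∈ K) (hQ : PathVia t Q x) (hw : w ∉ Q) (hQL : ∀ s ∈ Q, s ∉ L) :
    ∃ K' L', SPath y K' x ∧ SPath y L' x ∧ (∀ s ∈ K', s ∉ L') ∧
      (∀ s ∈ K', s ∈ K ∨ s ∈ Q) ∧ ∀ s ∈ L', s ∈ L ∨ s = w := by
  have h2 : PathVia y (L ++ [w]) x := hL.path.concat hx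
  obtain ⟨L', hL', hL's⟩ := h2.exists_spath hyx
  have hwK := hK.right
  have h1 : ∃ R, PathVia y R x ∧ (∀ s ∈ R, s ∈ K ∨ s ∈ Q) := by
    rcases ht with rfl | ht
    · exact ⟨Q, hQ, fun s hs => Or.inr hs⟩
    · obtain ⟨K₁, K₂, rfl, h1, -⟩ := hK.split ht
      refine ⟨K₁ ++ t :: Q, pathVia_append.2 ⟨h1.path, hQ⟩, fun s hs => ?_⟩
      grind
  obtain ⟨R, hR, hR'⟩ := h1
  obtain ⟨K', hK', hK's⟩ := hR.exists_spath hyx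
  refine ⟨K', L', hK', hL', fun s hs hs' => ?_, fun s hs => hR' s (hK's s hs), fun s hs => ?_⟩
  · have := hR' s (hK's s hs)
    have := hL's s hs'
    grind
  · have := hL's s hs
    grind

/-- There are two self-avoiding paths in `S` from `x` to `y` with no inner vertex in common. -/
def DisjPaths (S : Set (Site d)) (x y : Site d) : Prop :=
  ∃ K L, SPath x K y ∧ SPath x L y ∧ (∀ s ∈ K, s ∉ L) ∧ (∀ s ∈ K, s ∈ S) ∧ ∀ s ∈ L, s ∈ S

theorem disjPaths_of_adj (h : (lattice d).Adj x y) : DisjPaths S x y := by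
  have hp : SPath x [] y := ⟨h, by simp, by simp, by simp, h.ne⟩
  exact ⟨[], [], hp, hp, by simp, by simp, by simp⟩

/-- Inductive step for Menger's theorem. The connection from `y` to `x` avoiding `w` is cut at its
last visit to the two paths. Its tail replaces the end of the path that it leaves, and the other
path is prolonged through `w`. -/
theorem DisjPaths.step {w : Site d} (h : DisjPaths S y w) (hwS : w ∈ S)
    (hx : (lattice d).Adj w x) (hR : ConnIn (S \ {w}) y x) : DisjPaths S y x := by
  obtain ⟨K, L, hK, hL, hKL, hKS, hLS⟩ := h
  obtain ⟨hyx, R, hR, hRS⟩ := connIn_iff.1 hR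
  obtain ⟨t, ht, R', hR', hsub, hout⟩ := hR.exists_last_visit
    {s | s = y ∨ s ∈ K ∨ s ∈ L} (Or.inl rfl)
  have hwR : w ∉ R' := fun h => (hRS w (hsub w h)).2 rfl
  have hRin : ∀ s ∈ R', s ∈ S := fun s hs => (hRS s (hsub s hs)).1
  have hRK : ∀ s ∈ R', s ∉ K := fun s hs h => hout s hs (Or.inr (Or.inl h))
  have hRL : ∀ s ∈ R', s ∉ L := fun s hs h => hout s hs (Or.inr (Or.inr h))
  rcases or_assoc.2 ht with ht' | ht'
  · obtain ⟨K', L', h1, h2, h3, h4, h5⟩ :=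
      exists_disjoint_spath_of_branch hK hL hKL hx hyx ht' hR' hwR hRL
    refine ⟨K', L', h1, h2, h3, fun s hs => ?_, fun s hs => ?_⟩
    · exact (h4 s hs).elim (hKS s) (hRin s)
    · exact (h5 s hs).elim (hLS s) (fun h => h ▸ hwS)
  · obtain ⟨K', L', h1, h2, h3, h4, h5⟩ :=
      exists_disjoint_spath_of_branch hL hK (fun s hs hs' => hKL s hs' hs) hx hyx
        (Or.inr ht') hR' hwR hRK
    refine ⟨K', L', h1, h2, h3, fun s hs => ?_, fun s hs => ?_⟩
    · exact (h4 s hs).elim (hLS s) (hRin s)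
    · exact (h5 s hs).elim (hKS s) (fun h => h ▸ hwS)

/-- Menger's theorem for two paths: if no single site separates `y` from `u`, then there are two
paths from `y` to `u` with disjoint sets of inner vertices. -/
theorem disjPaths_of_forall_connIn (h : ConnIn S y u)
    (hS : ∀ s, s ≠ y → s ≠ u → ConnIn (S \ {s}) y u) : DisjPaths S y u := by
  obtain ⟨Q, hQ, hQS⟩ := h.exists_spath
  have hyQ := hQ.left
  have huQ := hQ.right
  have hnd := hQ.nodup
  have hsub (w : Site d) : S \ {w} ⊆ insert u S \ {w} :=
    Set.sdiff_subset_sdiff_left (Set.subset_insert _ _)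
  -- The pair of paths is pushed forward along `Q`. The detour around `w` runs from `y` to `u` and
  -- then back along `Q` to `x`, so `u` has to be admitted as an inner vertex; it is removed again
  -- at the end because a self-avoiding path to `u` has no inner visit to `u`.
  have key : ∀ (Q₁ : List (Site d)) (x : Site d) (Q₂ : List (Site d)), Q = Q₁ ++ x :: Q₂ →
      DisjPaths (insert u S) y x := by
    intro Q₁
    induction Q₁ using List.reverseRecOn with
    | nil =>
      intro x Q₂ hx
      have hp := hQ.path
      rw [hx] at hp
      exact disjPaths_of_adj hp.1
    | append_singleton Q₀ w ih =>
      intro x Q₂ hx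
      have hp := hQ.path
      rw [hx, pathVia_append, pathVia_append] at hp
      have hwu : w ≠ u := by grind
      have hwy : w ≠ y := by grind
      have hyx : y ≠ x := by grind
      have hxu : x ≠ u := by grind
      refine (ih w (x :: Q₂) (by simp [hx])).step (Or.inr (hQS w (by simp [hx]))) hp.1.2 ?_
      refine ((hS w hwy hwu).mono (hsub w)).trans ⟨by simp, Ne.symm hwu⟩ (ConnIn.symm ?_) hyx
      refine hp.2.connIn hxu fun s hs => ⟨Or.inr (hQS s (by simp [hx, hs])), ?_⟩
      rintro rfl
      grind
  suffices H : DisjPaths (insert u S) y u by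
    obtain ⟨K, L, hK, hL, hKL, hKS, hLS⟩ := H
    refine ⟨K, L, hK, hL, hKL, fun s hs => ?_, fun s hs => ?_⟩
    · exact (hKS s hs).resolve_left fun h => hK.right (h ▸ hs)
    · exact (hLS s hs).resolve_left fun h => hL.right (h ▸ hs)
  rcases List.eq_nil_or_concat' Q with rfl | ⟨Q₀, w, rfl⟩
  · exact disjPaths_of_adj hQ.path
  · have hp := pathVia_append.1 hQ.path
    refine (key Q₀ w [] rfl).step (Or.inr (hQS w (by simp))) hp.2 ?_
    exact (hS w (by grind) (by grind)).mono (hsub w)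

end Paths

/-! ### Disjoint connections forced by the lace-expansion events -/

section Diagrams

/-- The family generating the disjoint occurrence of a list of increasing events. -/
def boxList {ι : Type*} [DecidableEq ι] : List (Set (Finset ι)) → Set (Finset ι)
  | [] => {∅}
  | 𝒜 :: l => box 𝒜 (boxList l)

theorem setBernoulli_up_boxList_le {ι : Type*} [DecidableEq ι] [Countable ι] (p : I)
    (l : List (Set (Finset ι))) :
    setBernoulli Set.univ p (up (boxList l)) ≤
      (l.map fun 𝒜 => setBernoulli Set.univ p (up 𝒜)).prod := by
  induction l with
  | nil => exact prob_le_one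
  | cons 𝒜 l ih =>
    rw [List.map_cons, List.prod_cons]
    exact (setBernoulli_up_box_le p 𝒜 (boxList l)).trans (by gcongr)

theorem mem_up_boxList {ι : Type*} [DecidableEq ι] {ω : Set ι} {Ks : List (List ι)}
    {l : List (Set (Finset ι))} (h : List.Forall₂ (fun K 𝒜 => K.toFinset ∈ 𝒜) Ks l)
    (hd : Ks.Pairwise List.Disjoint) (hω : ∀ K ∈ Ks, ∀ s ∈ K, s ∈ ω) :
    ω ∈ up (boxList l) := by
  suffices H : Ks.flatten.toFinset ∈ boxList l by
    refine ⟨_, H, fun s hs => ?_⟩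
    obtain ⟨K, hK, hs⟩ := List.mem_flatten.1 (List.mem_toFinset.1 hs)
    exact hω K hK s hs
  clear hω
  induction h with
  | nil => simp [boxList]
  | @cons K 𝒜 Ks l hK _ ih =>
    rw [List.pairwise_cons] at hd
    refine ⟨_, hK, _, ih hd.2, ?_, by simp⟩
    rw [Finset.disjoint_left]
    intro s hs hs'
    obtain ⟨L, hL, hsL⟩ := List.mem_flatten.1 (List.mem_toFinset.1 hs')
    exact hd.1 L hL (List.mem_toFinset.1 hs) hsL

variable {d : ℕ} {x y z v u t b : Site d} {S : Set (Site d)} {l : List (Site d)} {ω : Config d}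
  {A : Set (Site d)}

/-- The sets of sites that connect `x` and `y`. -/
def cn (x y : Site d) : Set (Finset (Site d)) := {K | ConnIn (K : Set (Site d)) x y}

/-- The sets of sites that contain `y` and connect `x` and `y`. -/
def cnP (x y : Site d) : Set (Finset (Site d)) :=
  {K | y ∈ K ∧ ConnIn ((K : Set (Site d)) \ {y}) x y}

/-- All sets if `x = y`, and the sets that contain `y` and connect `x` and `y` otherwise. -/
def cnB (x y : Site d) : Set (Finset (Site d)) := {K | x = y ∨ K ∈ cnP x y}

/-- All sets if `x = y`, and the sets that connect `x` and `y` otherwise. -/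
def cnO (x y : Site d) : Set (Finset (Site d)) := {K | x = y ∨ K ∈ cn x y}

theorem SPath.mem_cn (h : SPath x l y) : l.toFinset ∈ cn x y :=
  h.connIn fun s hs => by simpa using hs

theorem SPath.mem_cnP (h : SPath x l y) : (l ++ [y]).toFinset ∈ cnP x y := by
  refine ⟨by simp, h.connIn fun s hs => ⟨by simp [hs], ?_⟩⟩
  rintro rfl
  exact h.right hs

theorem Arm.mem_cnB (h : Arm x l y) : l.toFinset ∈ cnB x y := by
  rcases h with ⟨h, -⟩ | ⟨l', rfl, h⟩
  · exact Or.inl h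
  · exact Or.inr h.mem_cnP

theorem PathVia.mem_cnO (h : PathVia x l y) : l.toFinset ∈ cnO x y := by
  by_cases hxy : x = y
  · exact Or.inl hxy
  · exact Or.inr (h.connIn hxy fun s hs => by simpa using hs)

/-- End points of a connection need not be occupied, so reaching a neighbour of the cluster is a
connection as well. -/
theorem connIn_of_mem_thick_modCluster (h : b ∈ thick (modCluster u v ω)) :
    b = v ∨ ConnIn (ω \ {u}) v b := by
  have key : ∀ a ∈ modCluster u v ω, a = v ∨ (a ∈ ω \ {u} ∧ ConnIn (ω \ {u}) v a) := by
    rintro a (ha | ⟨ha, ha'⟩)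
    · exact Or.inl ha
    · exact Or.inr ⟨ha, ha'⟩
  by_cases hb : b = v
  · exact Or.inl hb
  right
  rcases h with h | ⟨a, ha, hab⟩
  · exact ((key b h).resolve_left hb).2
  · have hadj : (lattice d).Adj a b := SimpleGraph.Adj.symm (G := lattice d) hab
    have hab' : ConnIn (ω \ {u}) a b := PathVia.connIn (l := []) hadj hadj.ne (by simp)
    rcases key a ha with rfl | ⟨h1, h2⟩
    · exact hab'
    · exact h2.trans h1 hab' (Ne.symm hb)

/-- Used with `Γ` the vertices of a backbone except its end `u`: the last visit to `Γ` is the branch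
point, and the rest of the path to `b` is disjoint from the backbone. -/
theorem exists_branch (h : b ∈ thick (modCluster u v ω)) (Γ : Set (Site d)) (hv : v ∈ Γ) :
    ∃ t ∈ Γ, ∃ Q : List (Site d), Q.toFinset ∈ cnO t b ∧ (∀ s ∈ Q, s ∈ ω) ∧ ∀ s ∈ Q, s ∉ Γ := by
  rcases connIn_of_mem_thick_modCluster h with rfl | h
  · exact ⟨b, hv, [], Or.inl rfl, by simp, by simp⟩
  · obtain ⟨-, l, hl, hlω⟩ := connIn_iff.1 h
    obtain ⟨t, ht, Q, h1, h2, h3⟩ := hl.exists_last_visit Γ hv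
    exact ⟨t, ht, Q, h1.mem_cnO, fun s hs => (hlω s (h2 s hs)).1, h3⟩

/-- The penultimate vertex of a self-avoiding path from `v` to `u` lies in the cluster. Thus each
step of the chain starts in the thickened previous cluster. -/
theorem mem_thick_modCluster_self (h : ConnIn ω v u) : u ∈ thick (modCluster u v ω) := by
  obtain ⟨l, hl, hlω⟩ := h.exists_spath
  have hr := hl.right
  have hne := hl.left
  have hp := hl.path
  have hnd := hl.nodup
  rcases List.eq_nil_or_concat' l with rfl | ⟨l', a, rfl⟩
  · exact Or.inr ⟨v, Or.inl rfl, hp.symm⟩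
  · obtain ⟨h1, h2⟩ := pathVia_append.1 hp
    have hau : a ≠ u := by grind
    have hva : v ≠ a := by grind
    refine Or.inr ⟨a, Or.inr ⟨⟨hlω a (by simp), hau⟩, ?_⟩, h2.symm⟩
    refine h1.connIn hva fun s hs => ⟨hlω s (by simp [hs]), ?_⟩
    rintro rfl
    simp [hs] at hr

theorem forall_not_or_exists_last {α : Type*} (P : α → Prop) (l : List α) :
    (∀ s ∈ l, ¬ P s) ∨ ∃ l₁ a l₂, l = l₁ ++ a :: l₂ ∧ P a ∧ ∀ s ∈ l₂, ¬ P s := by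
  induction l with
  | nil => simp
  | cons s l ih =>
    rcases ih with h | ⟨l₁, a, l₂, rfl, ha, h⟩
    · by_cases hs : P s
      · exact Or.inr ⟨[], s, l, rfl, hs, h⟩
      · left; simpa [hs] using h
    · exact Or.inr ⟨s :: l₁, a, l₂, rfl, ha, h⟩

/-- On `E'(v,u;A)` with `u ∉ ⟨A⟩`, the last pivotal site `y` is joined to `u` by two disjoint
paths, both of which visit `⟨A⟩`. -/
theorem exists_sausage (h : ω ∈ eventE' v u A) (hu : u ∉ thick A) :
    ∃ y N K L, Arm v N y ∧ SPath y K u ∧ SPath y L u ∧ (∀ s ∈ K, s ∉ L) ∧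
      (∀ s ∈ N, s ∉ K) ∧ (∀ s ∈ N, s ∉ L) ∧
      (∀ s ∈ N, s ∈ ω) ∧ (∀ s ∈ K, s ∈ ω) ∧ (∀ s ∈ L, s ∈ ω) ∧ u ∉ N ∧
      (∃ z ∈ K, z ∈ thick A) ∧ ∃ z ∈ L, z ∈ thick A := by
  obtain ⟨⟨hc, hoff⟩, hpiv⟩ := h
  have hoff' : ω ∉ offConn v u (thick A) := hoff.resolve_right hu
  obtain ⟨γ, hγ, hγω⟩ := ConnIn.exists_spath hc
  have hsub : ∀ y s : Site d, s ∈ ω → s ≠ y → s ∈ ω \ {y} := fun y s h1 h2 => ⟨h1, h2⟩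
  -- the last pivotal site, or `v` if there is none
  obtain ⟨y, N, R, hγe, hN, hR, hy, hlast⟩ : ∃ y N R, γ = N ++ R ∧ Arm v N y ∧ SPath y R u ∧
      (y = v ∨ (y ∈ piv (conn v u) ω ∧ v ≠ y)) ∧ ∀ s ∈ R, s ∉ piv (conn v u) ω := by
    rcases forall_not_or_exists_last (· ∈ piv (conn v u) ω) γ with h | ⟨l₁, a, l₂, he, ha, h⟩
    · exact ⟨v, [], γ, rfl, Or.inl ⟨rfl, rfl⟩, hγ, Or.inl rfl, h⟩
    · have hnd := hγ.nodup
      have h1 := hγ.left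
      have h2 := hγ.right
      have hp := hγ.path
      rw [he] at hnd h1 h2 hp
      obtain ⟨hp1, hp2⟩ := pathVia_append.1 hp
      refine ⟨a, l₁ ++ [a], l₂, by simp [he], Or.inr ⟨l₁, rfl, ?_⟩, ?_,
        Or.inr ⟨ha, by grind⟩, h⟩
      · exact ⟨hp1, by grind, by grind, by grind, by grind⟩
      · exact ⟨hp2, by grind, by grind, by grind, by grind⟩
  have hNω : ∀ s ∈ N, s ∈ ω := fun s hs => hγω s (by simp [hγe, hs])
  have hRω : ∀ s ∈ R, s ∈ ω := fun s hs => hγω s (by simp [hγe, hs])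
  -- no site separates `y` from `u`
  have hsep : ∀ s, s ≠ y → s ≠ u → ConnIn (ω \ {s}) y u := by
    intro s hsy hsu
    -- A pivotal `s` is not on `R`, by the choice of `y`. If `s` is not pivotal, some path from `v`
    -- to `u` avoids it, and that path passes through `y` when `y` is pivotal.
    by_cases hs : s ∈ piv (conn v u) ω
    · exact hR.connIn fun a ha => hsub s a (hRω a ha) fun h => hlast a ha (h ▸ hs)
    · have hs' : ConnIn (ω \ {s}) v u := by
        by_contra hn
        exact hs ⟨ConnIn.mono hc Set.subset_union_left, hn⟩
      rcases hy with rfl | ⟨hy, -⟩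
      · exact hs'
      · obtain ⟨hne, l, hl, hlω⟩ := connIn_iff.1 hs'
        have hyl : y ∈ l := by
          by_contra hyl
          exact hy.2 (hl.connIn hne fun a ha => hsub y a (hlω a ha).1 fun h => hyl (h ▸ ha))
        obtain ⟨l₁, l₂, rfl⟩ := List.append_of_mem hyl
        exact (pathVia_append.1 hl).2.connIn hR.ne fun a ha => hlω a (by simp [ha])
  obtain ⟨K, L, hK, hL, hKL, hKω, hLω⟩ :=
    disjPaths_of_forall_connIn (hR.connIn hRω) hsep
  -- A common site of the stem and a side of the sausage would give a shortcut from `v` to `u`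
  -- around the pivotal site `y`.
  have hdisj : ∀ K, SPath y K u → (∀ s ∈ K, s ∈ ω) → ∀ s ∈ N, s ∉ K := by
    intro K hK hKω s hs hsK
    rcases hN with ⟨-, rfl⟩ | ⟨M, rfl, hM⟩
    · simp at hs
    have hy' : y ∈ piv (conn v u) ω := (hy.resolve_left hM.ne.symm).1
    rcases List.mem_append.1 hs with hsM | hsy
    · obtain ⟨M₁, M₂, rfl, hM₁, -⟩ := hM.split hsM
      obtain ⟨K₁, K₂, rfl, -, hK₂⟩ := hK.split hsK
      refine hy'.2 ((pathVia_append.2 ⟨hM₁.path, hK₂.path⟩).connIn hγ.ne fun a ha => ?_)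
      have h1 := hM.right
      have h2 := hK.left
      simp only [List.mem_append, List.mem_cons] at ha
      rcases ha with ha | rfl | ha
      · exact hsub y a (hNω a (by simp [ha])) (by rintro rfl; simp [ha] at h1)
      · exact hsub y a (hKω a (by simp)) (by rintro rfl; simp at h1)
      · exact hsub y a (hKω a (by simp [ha])) (by rintro rfl; simp [ha] at h2)
    · obtain rfl := List.mem_singleton.1 hsy
      exact hK.left hsK
  -- If `y` is pivotal, `E'` says that `v` does not reach `y` through `A`, so `v` is connected to
  -- `y` off `⟨A⟩` and `y ∉ ⟨A⟩`. A side avoiding `⟨A⟩` would then connect `v` to `u` off `⟨A⟩`.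
  have hvisit : ∀ K, SPath y K u → (∀ s ∈ K, s ∈ ω) → ∃ z ∈ K, z ∈ thick A := by
    intro K hK hKω
    by_contra! hn
    rcases hN with ⟨rfl, -⟩ | ⟨M, rfl, hM⟩
    · exact hoff' (hK.connIn fun s hs => ⟨hKω s hs, hn s hs⟩)
    · have hy' : y ∈ piv (conn v u) ω := (hy.resolve_left hM.ne.symm).1
      have hconn : ω ∈ conn v y := hM.connIn fun s hs => hNω s (by simp [hs])
      have hnt : ω ∉ throughConn A v y := fun h => hpiv ⟨y, hy', h⟩
      have h1 : y ∉ thick A := fun h => hnt ⟨hconn, Or.inr h⟩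
      have h2 : ω ∈ offConn v y (thick A) := by
        by_contra h
        exact hnt ⟨hconn, Or.inl h⟩
      refine hoff' (ConnIn.trans h2 ⟨hNω y (by simp), h1⟩ ?_ hγ.ne)
      exact hK.connIn fun s hs => ⟨hKω s hs, hn s hs⟩
  refine ⟨y, N, K, L, hN, hK, hL, hKL, hdisj K hK hKω, hdisj L hL hLω, hNω, hKω, hLω, ?_,
    hvisit K hK hKω, hvisit L hL hLω⟩
  intro h
  exact hγ.right (by simp [hγe, h])

/-- The diagram for the case that `z` and the branch point `t` lie on different sides of the
sausage. -/
theorem mem_up_side {N K L Q : List (Site d)} (hN : Arm v N y) (hK : SPath y K u)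
    (hL : SPath y L u) (hKL : ∀ s ∈ K, s ∉ L) (hNK : ∀ s ∈ N, s ∉ K) (hNL : ∀ s ∈ N, s ∉ L)
    (hNω : ∀ s ∈ N, s ∈ ω) (hKω : ∀ s ∈ K, s ∈ ω) (hLω : ∀ s ∈ L, s ∈ ω)
    (hz : z ∈ K) (ht : t ∈ L) (hQ : Q.toFinset ∈ cnO t b) (hQω : ∀ s ∈ Q, s ∈ ω)
    (hQd : ∀ s ∈ Q, s ∉ N ∧ s ∉ K ∧ s ∉ L) :
    ω ∈ up (boxList [cnB v y, cnP y z, cn z u, cnP y t, cn t u, cnO t b]) := by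
  have hKn := hK.nodup
  have hLn := hL.nodup
  obtain ⟨K₁, K₂, rfl, hK₁, hK₂⟩ := hK.split hz
  obtain ⟨L₁, L₂, rfl, hL₁, hL₂⟩ := hL.split ht
  simp only [List.mem_append, List.mem_cons] at hKL hNK hNL hQd
  refine mem_up_boxList (Ks := [N, K₁ ++ [z], K₂, L₁ ++ [t], L₂, Q]) ?_ ?_ ?_
  · simp only [List.forall₂_cons, List.forall₂_nil_left_iff, and_true]
    exact ⟨hN.mem_cnB, hK₁.mem_cnP, hK₂.mem_cn, hL₁.mem_cnP, hL₂.mem_cn, hQ⟩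
  · simp only [List.pairwise_cons, List.mem_cons, List.not_mem_nil, List.Disjoint]
    grind
  · simp only [List.mem_cons, List.not_mem_nil]
    grind

/-- The diagram for the case that the branch point `t` lies before the sausage. -/
theorem mem_up_stem {N K L Q : List (Site d)} (hN : Arm v N y) (hK : SPath y K u)
    (hL : SPath y L u) (hKL : ∀ s ∈ K, s ∉ L) (hNK : ∀ s ∈ N, s ∉ K) (hNL : ∀ s ∈ N, s ∉ L)
    (hNω : ∀ s ∈ N, s ∈ ω) (hKω : ∀ s ∈ K, s ∈ ω) (hLω : ∀ s ∈ L, s ∈ ω)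
    (hz : z ∈ K) (ht : t = v ∨ t ∈ N) (hQ : Q.toFinset ∈ cnO t b) (hQω : ∀ s ∈ Q, s ∈ ω)
    (hQd : ∀ s ∈ Q, s ∉ N ∧ s ∉ K ∧ s ∉ L) :
    ω ∈ up (boxList [cnB v t, cnB t y, cnP y z, cn z u, cn y u, cnO t b]) := by
  have hKn := hK.nodup
  have hNn := hN.nodup
  obtain ⟨K₁, K₂, rfl, hK₁, hK₂⟩ := hK.split hz
  obtain ⟨N₁, N₂, rfl, hN₁, hN₂⟩ := hN.split ht
  simp only [List.mem_append, List.mem_cons] at hKL hNK hNL hQd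
  refine mem_up_boxList (Ks := [N₁, N₂, K₁ ++ [z], K₂, L, Q]) ?_ ?_ ?_
  · simp only [List.forall₂_cons, List.forall₂_nil_left_iff, and_true]
    exact ⟨hN₁.mem_cnB, hN₂.mem_cnB, hK₁.mem_cnP, hK₂.mem_cn, hL.mem_cn, hQ⟩
  · simp only [List.pairwise_cons, List.mem_cons, List.not_mem_nil, List.Disjoint]
    grind
  · simp only [List.mem_cons, List.not_mem_nil]
    grind

theorem exists_diagram_of_mem_eventE' (h : ω ∈ eventE' v u A)
    (hb : b ∈ thick (modCluster u v ω)) :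
    ∃ z ∈ thick A, ∃ t ≠ u, (z = u ∧ ω ∈ up (boxList [cnB v t, cn t u, cnO t b])) ∨
      (∃ y, ω ∈ up (boxList [cnB v t, cnB t y, cnP y z, cn z u, cn y u, cnO t b])) ∨
      ∃ y, ω ∈ up (boxList [cnB v y, cnP y z, cn z u, cnP y t, cn t u, cnO t b]) := by
  by_cases hu : u ∈ thick A
  · obtain ⟨γ, hγ, hγω⟩ := ConnIn.exists_spath h.1.1
    obtain ⟨t, ht, Q, hQ, hQω, hQd⟩ := exists_branch hb {s | s = v ∨ s ∈ γ} (Or.inl rfl)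
    have hγn := hγ.nodup
    have htu : t ≠ u := by
      rintro rfl
      exact ht.elim (fun h => hγ.ne h.symm) hγ.right
    refine ⟨u, hu, t, htu, Or.inl ⟨rfl, ?_⟩⟩
    obtain ⟨γ₁, γ₂, rfl, h1, h2⟩ := hγ.exists_arm ht
    have hQd' : ∀ s ∈ Q, s ∉ γ₁ ∧ s ∉ γ₂ := fun s hs =>
      ⟨fun h => hQd s hs (Or.inr (by simp [h])), fun h => hQd s hs (Or.inr (by simp [h]))⟩
    refine mem_up_boxList (Ks := [γ₁, γ₂, Q]) ?_ ?_ ?_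
    · simp only [List.forall₂_cons, List.forall₂_nil_left_iff, and_true]
      exact ⟨h1.mem_cnB, h2.mem_cn, hQ⟩
    · simp only [List.pairwise_cons, List.mem_cons, List.not_mem_nil, List.Disjoint]
      grind
    · simp only [List.mem_cons, List.not_mem_nil]
      grind
  · obtain ⟨y, N, K, L, hN, hK, hL, hKL, hNK, hNL, hNω, hKω, hLω, huN, ⟨z, hzK, hz⟩,
      z', hzL, hz'⟩ := exists_sausage h hu
    obtain ⟨t, ht, Q, hQ, hQω, hQd⟩ := exists_branch hb
      {s | (s = v ∨ s ∈ N) ∨ s ∈ K ∨ s ∈ L} (Or.inl (Or.inl rfl))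
    have hvu : v ≠ u := h.1.1.1
    have hQd' : ∀ s ∈ Q, s ∉ N ∧ s ∉ K ∧ s ∉ L := fun s hs =>
      ⟨fun h => hQd s hs (Or.inl (Or.inr h)), fun h => hQd s hs (Or.inr (Or.inl h)),
        fun h => hQd s hs (Or.inr (Or.inr h))⟩
    have htu : t ≠ u := by
      rintro rfl
      rcases ht with (h | h) | h | h
      · exact hvu h.symm
      · exact huN h
      · exact hK.right h
      · exact hL.right h
    -- When `t` lies on one side of the sausage, the visit to `⟨A⟩` is taken on the other side; this
    -- is why both sides must visit `⟨A⟩`.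
    rcases ht with ht | ht | ht
    · exact ⟨z, hz, t, htu, Or.inr (Or.inl ⟨y, mem_up_stem hN hK hL hKL hNK hNL hNω hKω hLω hzK ht
        hQ hQω hQd'⟩)⟩
    · exact ⟨z', hz', t, htu, Or.inr (Or.inr ⟨y, mem_up_side hN hL hK (fun s h1 h2 => hKL s h2 h1)
        hNL hNK hNω hLω hKω hzL ht hQ hQω (fun s hs => by have := hQd' s hs; tauto)⟩)⟩
    · exact ⟨z, hz, t, htu, Or.inr (Or.inr ⟨y, mem_up_side hN hK hL hKL hNK hNL hNω hKω hLω hzK ht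
        hQ hQω hQd'⟩)⟩

/-- The configuration `ω ∩ K` agrees with `ω` on the witness `K`, so the connection already occurs
inside `ω ∩ K`; likewise for `L`. -/
theorem exists_disjoint_spath_of_mem_dblConn (h : ω ∈ dblConn v u) : DisjPaths ω v u := by
  obtain ⟨K, L, hd, hK, hL⟩ := h
  obtain ⟨k, hk, hkK⟩ := ConnIn.exists_spath (hK (show ω ∩ K ∈ cyl ω K by simp +contextual [cyl]))
  obtain ⟨l, hl, hlL⟩ := ConnIn.exists_spath (hL (show ω ∩ L ∈ cyl ω L by simp +contextual [cyl]))
  exact ⟨k, l, hk, hl, fun s hs hs' => Set.disjoint_left.1 hd (hkK s hs).2 (hlL s hs').2,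
    fun s hs => (hkK s hs).1, fun s hs => (hlL s hs).1⟩

theorem exists_diagram_of_mem_dblConn (h : ω ∈ dblConn v u)
    (hb : b ∈ thick (modCluster u v ω)) :
    ∃ t ≠ u, ω ∈ up (boxList [cnB v t, cn t u, cn v u, cnO t b]) := by
  obtain ⟨K, L, hK, hL, hKL, hKω, hLω⟩ := exists_disjoint_spath_of_mem_dblConn h
  obtain ⟨t, ht, Q, hQ, hQω, hQd⟩ := exists_branch hb
    {s | (s = v ∨ s ∈ K) ∨ s ∈ L} (Or.inl (Or.inl rfl))
  have htu : t ≠ u := by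
    rintro rfl
    rcases ht with (h | h) | h
    · exact hK.ne h.symm
    · exact hK.right h
    · exact hL.right h
  have hQd' : ∀ s ∈ Q, s ∉ K ∧ s ∉ L := fun s hs =>
    ⟨fun h => hQd s hs (Or.inl (Or.inr h)), fun h => hQd s hs (Or.inr h)⟩
  have key : ∀ K L, SPath v K u → SPath v L u → (∀ s ∈ K, s ∉ L) → (∀ s ∈ K, s ∈ ω) →
      (∀ s ∈ L, s ∈ ω) → (t = v ∨ t ∈ K) → (∀ s ∈ Q, s ∉ K ∧ s ∉ L) →
      ω ∈ up (boxList [cnB v t, cn t u, cn v u, cnO t b]) := by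
    intro K L hK hL hKL hKω hLω ht hQd
    have hKn := hK.nodup
    obtain ⟨K₁, K₂, rfl, h1, h2⟩ := hK.exists_arm ht
    refine mem_up_boxList (Ks := [K₁, K₂, L, Q]) ?_ ?_ ?_
    · simp only [List.forall₂_cons, List.forall₂_nil_left_iff, and_true]
      exact ⟨h1.mem_cnB, h2.mem_cn, hL.mem_cn, hQ⟩
    · simp only [List.pairwise_cons, List.mem_cons, List.not_mem_nil, List.Disjoint]
      grind
    · simp only [List.mem_cons, List.not_mem_nil]
      grind
  refine ⟨t, htu, ?_⟩
  rcases ht with ht | ht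
  · exact key K L hK hL hKL hKω hLω ht hQd'
  · exact key L K hL hK (fun s h1 h2 => hKL s h2 h1) hLω hKω (Or.inr ht)
      fun s hs => (hQd' s hs).symm

end Diagrams

/-! ### Translation invariance and bounds by two-point functions -/

section Probabilities

variable {d : ℕ} {x y z v u t b w : Site d} {l : List (Site d)} (p : I)

theorem up_cn (x y : Site d) : up (cn x y) = conn x y := by
  ext ω
  constructor
  · rintro ⟨K, hK, hKω⟩
    exact ConnIn.mono hK hKω
  · intro h
    obtain ⟨l, hl, hlω⟩ := ConnIn.exists_spath h
    exact ⟨l.toFinset, hl.mem_cn, fun s hs => hlω s (by simpa using hs)⟩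

theorem lattice_adj_sub (a : Site d) (h : (lattice d).Adj x y) :
    (lattice d).Adj (x - a) (y - a) := by
  change norm1 _ = 1
  rw [sub_sub_sub_cancel_right]
  exact h

theorem PathVia.sub (a : Site d) (h : PathVia x l y) :
    PathVia (x - a) (l.map (· - a)) (y - a) := by
  induction l generalizing x with
  | nil => exact lattice_adj_sub a h
  | cons s l ih => exact ⟨lattice_adj_sub a h.1, ih h.2⟩

theorem ConnIn.sub {S : Set (Site d)} (a : Site d) (h : ConnIn S x y) :
    ConnIn ((fun s => s + a) ⁻¹' S) (x - a) (y - a) := by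
  obtain ⟨hne, l, hl, hlS⟩ := connIn_iff.1 h
  refine (hl.sub a).connIn (by simpa using hne) fun s hs => ?_
  obtain ⟨r, hr, rfl⟩ := List.mem_map.1 hs
  simpa using hlS r hr

theorem conn_eq_preimage (x y : Site d) :
    conn x y = (fun ω : Config d => (fun s => s + x) ⁻¹' ω) ⁻¹' conn 0 (y - x) := by
  ext ω
  constructor
  · intro h
    simpa [conn] using ConnIn.sub x h
  · intro h
    have := ConnIn.sub (-x) h
    simpa [conn, Set.preimage_preimage] using this

theorem measurableSet_conn (x y : Site d) : MeasurableSet (conn x y) := by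
  rw [← up_cn]
  exact measurableSet_up _

theorem perc_conn (x y : Site d) : perc d p (conn x y) = tau p (y - x) := by
  rw [conn_eq_preimage, ← Measure.map_apply (measurable_preimage_config _) (measurableSet_conn _ _),
    perc, setBernoulli_map_preimage p _ (add_left_injective x)]
  rfl

theorem tau_neg (x : Site d) : tau p (-x) = tau p x := by
  have h : conn 0 x = conn x 0 := Set.ext fun ω => ⟨ConnIn.symm, ConnIn.symm⟩
  rw [tau, tau, h, perc_conn, perc_conn, sub_zero, zero_sub]

theorem tauO_neg (x : Site d) : tauO p (-x) = tauO p x := by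
  simp [tauO, tau_neg]

theorem tau_le_one (x : Site d) : tau p x ≤ 1 := by
  rw [tau, perc]
  exact prob_le_one

theorem perc_up_cn (x y : Site d) : perc d p (up (cn x y)) = tau p (y - x) := by
  rw [up_cn, perc_conn]

/-- Occupation of `y` and the connection, which does not use `y`, occur disjointly, so the
inequality of van den Berg and Kesten gives the factor `p`. -/
theorem perc_up_cnP_le (x y : Site d) : perc d p (up (cnP x y)) ≤ pE p * tau p (y - x) := by
  have h : cnP x y ⊆ box {{y}} (cn x y) := by
    rintro K ⟨hy, hK⟩
    refine ⟨{y}, rfl, K.erase y, ?_, by simp, ?_⟩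
    · simpa [cn] using hK
    · ext s
      by_cases hs : s = y <;> simp [hs, hy]
  have h1 : up ({{y}} : Set (Finset (Site d))) = occ {y} := by
    ext ω; simp [up, occ]
  calc perc d p (up (cnP x y)) ≤ perc d p (up (box {{y}} (cn x y))) := measure_mono (up_mono h)
    _ ≤ perc d p (up {{y}}) * perc d p (up (cn x y)) := setBernoulli_up_box_le p _ _
    _ = pE p * tau p (y - x) := by
      rw [h1, perc_up_cn, perc, setBernoulli_occ]
      simp

theorem perc_up_cnB_le (x y : Site d) : perc d p (up (cnB x y)) ≤ tauB p (y - x) := by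
  by_cases hxy : x = y
  · subst hxy
    refine le_trans (b := 1) ?_ (by simp [tauB])
    rw [perc]
    exact prob_le_one
  · have : cnB x y = cnP x y := by
      ext K; simp [cnB, hxy]
    rw [this]
    exact (perc_up_cnP_le p x y).trans le_add_self

theorem perc_up_cnO_le (x y : Site d) : perc d p (up (cnO x y)) ≤ tauO p (y - x) := by
  by_cases hxy : x = y
  · subst hxy
    refine le_trans (b := 1) ?_ (by simp [tauO])
    rw [perc]
    exact prob_le_one
  · have : cnO x y = cn x y := by
      ext K; simp [cnO, hxy]
    rw [this, perc_up_cn]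
    exact le_add_self

/-- The diagram in which the branch point `t` lies before the sausage between `y` and `u`. -/
noncomputable def phiStem (v u z t y : Site d) : ℝ≥0∞ :=
  tauB p (t - v) * tauB p (y - t) * (pE p * tau p (z - y)) * tau p (u - z) * tau p (u - y)

/-- The diagram in which the branch point `t` lies on the sausage between `y` and `u`. -/
noncomputable def phiSide (v u z t y : Site d) : ℝ≥0∞ :=
  tauB p (y - v) * (pE p * tau p (z - y)) * tau p (u - z) * (pE p * tau p (t - y)) * tau p (u - t)

/-- The sum of the diagrams that bound `E'(v,u;A)`, where `z ∈ ⟨A⟩` and `t` is the branch point. -/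
noncomputable def phi (v u z t : Site d) : ℝ≥0∞ :=
  (if z = u then tauB p (t - v) * tau p (u - t) else 0) + ∑' y, phiStem p v u z t y
    + ∑' y, phiSide p v u z t y

theorem measure_iUnion_prop_le {Ω : Type*} [MeasurableSpace Ω] (μ : Measure Ω) {P : Prop}
    [Decidable P] {s : Set Ω} {c : ℝ≥0∞} (h : P → μ s ≤ c) :
    μ (⋃ _ : P, s) ≤ if P then c else 0 := by
  by_cases hP : P
  · simpa [hP] using h hP
  · simp [hP]

theorem perc_up_boxList_le (l : List (Set (Finset (Site d)))) :
    perc d p (up (boxList l)) ≤ (l.map fun 𝒜 => perc d p (up 𝒜)).prod :=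
  setBernoulli_up_boxList_le p l

-- A union bound over the positions of `z`, `t` and `y`, then one factor per disjoint connection.
-- The sites `z` and `b` are the interfaces with the preceding and the following configuration.
open Classical in
theorem perc_eventE'_inter_le (v u b : Site d) (A : Set (Site d)) :
    perc d p (eventE' v u A ∩ {ω | b ∈ thick (modCluster u v ω)}) ≤
      ∑' z, if z ∈ thick A then ∑' t, if t ≠ u then phi p v u z t * tauO p (b - t) else 0 else 0 := by
  have hsub : eventE' v u A ∩ {ω | b ∈ thick (modCluster u v ω)} ⊆
      ⋃ z, ⋃ (_ : z ∈ thick A), ⋃ t, ⋃ (_ : t ≠ u),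
        ((⋃ (_ : z = u), up (boxList [cnB v t, cn t u, cnO t b])) ∪
        (⋃ y, up (boxList [cnB v t, cnB t y, cnP y z, cn z u, cn y u, cnO t b]))) ∪
        ⋃ y, up (boxList [cnB v y, cnP y z, cn z u, cnP y t, cn t u, cnO t b]) := by
    rintro ω ⟨h1, h2⟩
    obtain ⟨z, hz, t, ht, h⟩ := exists_diagram_of_mem_eventE' h1 h2
    simp only [Set.mem_iUnion, Set.mem_union]
    refine ⟨z, hz, t, ht, ?_⟩
    rcases h with ⟨h, h'⟩ | h | h
    · exact Or.inl (Or.inl ⟨h, h'⟩)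
    · exact Or.inl (Or.inr h)
    · exact Or.inr h
  refine (measure_mono hsub).trans ?_
  refine (measure_iUnion_le _).trans (ENNReal.tsum_le_tsum fun z => ?_)
  refine measure_iUnion_prop_le _ fun _ => ?_
  refine (measure_iUnion_le _).trans (ENNReal.tsum_le_tsum fun t => ?_)
  refine measure_iUnion_prop_le _ fun _ => ?_
  rw [phi, add_mul, add_mul, ← ENNReal.tsum_mul_right, ← ENNReal.tsum_mul_right]
  refine (measure_union_le _ _).trans (add_le_add ((measure_union_le _ _).trans
    (add_le_add ?_ ?_)) ?_)
  · rw [ite_mul, zero_mul]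
    refine measure_iUnion_prop_le _ fun _ => (perc_up_boxList_le p _).trans ?_
    simp only [List.map_cons, List.map_nil, List.prod_cons, List.prod_nil, mul_one, perc_up_cn]
    rw [mul_assoc]
    gcongr
    · exact perc_up_cnB_le p _ _
    · exact perc_up_cnO_le p _ _
  · refine (measure_iUnion_le _).trans (ENNReal.tsum_le_tsum fun y => ?_)
    refine (perc_up_boxList_le p _).trans ?_
    simp only [List.map_cons, List.map_nil, List.prod_cons, List.prod_nil, mul_one, perc_up_cn]
    rw [phiStem]
    simp only [mul_assoc]
    rw [← mul_assoc (pE p)]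
    gcongr
    · exact perc_up_cnB_le p _ _
    · exact perc_up_cnB_le p _ _
    · exact perc_up_cnP_le p _ _
    · exact perc_up_cnO_le p _ _
  · refine (measure_iUnion_le _).trans (ENNReal.tsum_le_tsum fun y => ?_)
    refine (perc_up_boxList_le p _).trans ?_
    simp only [List.map_cons, List.map_nil, List.prod_cons, List.prod_nil, mul_one, perc_up_cn]
    rw [phiSide]
    have : tauB p (y - v) * (pE p * tau p (z - y)) * tau p (u - z) * (pE p * tau p (t - y)) *
        tau p (u - t) * tauO p (b - t) = tauB p (y - v) * ((pE p * tau p (z - y)) *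
        (tau p (u - z) * ((pE p * tau p (t - y)) * (tau p (u - t) * tauO p (b - t))))) := by ring
    rw [this]
    gcongr
    · exact perc_up_cnB_le p _ _
    · exact perc_up_cnP_le p _ _
    · exact perc_up_cnP_le p _ _
    · exact perc_up_cnO_le p _ _

open Classical in
theorem perc_dblConn_inter_le (v u b : Site d) :
    perc d p (dblConn v u ∩ {ω | b ∈ thick (modCluster u v ω)}) ≤
      ∑' t, if t ≠ u then tauB p (t - v) * tau p (u - t) * tau p (u - v) * tauO p (b - t) else 0 := by
  have hsub : dblConn v u ∩ {ω | b ∈ thick (modCluster u v ω)} ⊆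
      ⋃ t, ⋃ (_ : t ≠ u), up (boxList [cnB v t, cn t u, cn v u, cnO t b]) := by
    rintro ω ⟨h1, h2⟩
    obtain ⟨t, ht, h⟩ := exists_diagram_of_mem_dblConn h1 h2
    simp only [Set.mem_iUnion]
    exact ⟨t, ht, h⟩
  refine (measure_mono hsub).trans ?_
  refine (measure_iUnion_le _).trans (ENNReal.tsum_le_tsum fun t => ?_)
  refine measure_iUnion_prop_le _ fun _ => ?_
  refine (perc_up_boxList_le p _).trans ?_
  simp only [List.map_cons, List.map_nil, List.prod_cons, List.prod_nil, mul_one, perc_up_cn]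
  simp only [mul_assoc]
  gcongr
  · exact perc_up_cnB_le p _ _
  · exact perc_up_cnO_le p _ _

end Probabilities

/-! ### Convolution identities -/

section Convolutions

variable {d : ℕ} (f g h : Site d → ℝ≥0∞)

theorem conv_comm : conv f g = conv g f := by
  ext x
  rw [conv, conv, ← (Equiv.subLeft x).tsum_eq]
  exact tsum_congr fun y => by simp [mul_comm]

theorem tsum_sub_mul (v w : Site d) : ∑' y, f (y - v) * g (w - y) = conv f g (w - v) := by
  rw [conv, ← (Equiv.addRight v).tsum_eq]
  exact tsum_congr fun y => by simp [sub_sub, add_comm]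

theorem conv_assoc : conv (conv f g) h = conv f (conv g h) := by
  ext x
  calc conv (conv f g) h x = ∑' y, ∑' s, f s * g (y - s) * h (x - y) := by
        simp_rw [conv, ENNReal.tsum_mul_right]
    _ = ∑' s, ∑' y, f s * (g (y - s) * h (x - y)) := by
        rw [ENNReal.tsum_comm]
        simp_rw [mul_assoc]
    _ = conv f (conv g h) x := by
        simp_rw [ENNReal.tsum_mul_left, tsum_sub_mul]
        rfl

theorem conv_right_comm : conv (conv f g) h = conv (conv f h) g := by
  rw [conv_assoc, conv_comm g h, conv_assoc]

theorem conv_neg (hf : ∀ x, f (-x) = f x) (hg : ∀ x, g (-x) = g x) (x : Site d) :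
    conv f g (-x) = conv f g x := by
  rw [conv, conv, ← (Equiv.neg _).tsum_eq]
  refine tsum_congr fun y => ?_
  rw [Equiv.neg_apply, hf, ← hg, neg_sub, sub_neg_eq_add, sub_eq_neg_add]

end Convolutions

/-! ### Summing the diagrams to triangles -/

section Triangles

variable {d : ℕ} (p : I)

theorem tsum_phi_direct (v w : Site d) :
    ∑' z, tauO p (z - w) * ∑' u, pE p * ∑' t, (if z = u then tauB p (t - v) * tau p (u - t) else 0)
      = triBO p (w - v) := by
  have h1 : ∀ z : Site d, ∑' u, pE p *
      ∑' t, (if z = u then tauB p (t - v) * tau p (u - t) else 0) =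
      pE p * conv (tauB p) (tau p) (z - v) := by
    intro z
    rw [tsum_eq_single z]
    · simp [tsum_sub_mul]
    · intro u hu
      simp [hu.symm]
  simp_rw [h1]
  rw [triBO, conv_right_comm, ← tsum_sub_mul, ← ENNReal.tsum_mul_left]
  refine tsum_congr fun z => ?_
  rw [← tauO_neg, neg_sub]
  ring

/-- The closed triangle through `y`, `z`, `u` carries the factors `p` of `z` and `u` and gives
`△(0)`; the remaining path from `v` through `t` and `y`, closed up towards `w`, gives `△^{••∘}`. -/
theorem tsum_phiStem_le (v w : Site d) :
    ∑' z, tauO p (z - w) * ∑' u, pE p * ∑' t, ∑' y, phiStem p v u z t y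
      ≤ triSup d p * triBBOSup d p := by
  set D := conv (tauB p) (tauB (d := d) p) with hD
  set B := conv (tau p) (tau (d := d) p) with hB
  have hBneg : ∀ x, B (-x) = B x := conv_neg _ _ (tau_neg p) (tau_neg p)
  have h1 : ∀ z : Site d, ∑' u, pE p * ∑' t, ∑' y, phiStem p v u z t y =
      ∑' y, D (y - v) * (pE p ^ 2 * (B (z - y) * tau p (z - y))) := by
    intro z
    calc ∑' u, pE p * ∑' t, ∑' y, phiStem p v u z t y
        = ∑' u, ∑' y, ∑' t, (tauB p (t - v) * tauB p (y - t)) *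
            (pE p ^ 2 * tau p (z - y) * (tau p (u - z) * tau p (y - u))) := by
          refine tsum_congr fun u => ?_
          rw [ENNReal.tsum_comm, ← ENNReal.tsum_mul_left]
          refine tsum_congr fun y => ?_
          rw [← ENNReal.tsum_mul_left]
          refine tsum_congr fun t => ?_
          rw [phiStem, ← tau_neg p (y - u), neg_sub]
          ring
      _ = ∑' u, ∑' y, D (y - v) *
            (pE p ^ 2 * tau p (z - y) * (tau p (u - z) * tau p (y - u))) := by
          simp_rw [ENNReal.tsum_mul_right, tsum_sub_mul, hD]
      _ = ∑' y, D (y - v) * (pE p ^ 2 * tau p (z - y) * B (y - z)) := by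
          rw [ENNReal.tsum_comm]
          simp_rw [ENNReal.tsum_mul_left, tsum_sub_mul, hB]
      _ = _ := by
          refine tsum_congr fun y => ?_
          rw [← hBneg (y - z), neg_sub]
          ring
  simp_rw [h1]
  calc ∑' z, tauO p (z - w) * ∑' y, D (y - v) * (pE p ^ 2 * (B (z - y) * tau p (z - y)))
      = ∑' y, ∑' z, tauO p (w - z) * (D (y - v) * (pE p ^ 2 * (B (z - y) * tau p (z - y)))) := by
        rw [ENNReal.tsum_comm]
        refine tsum_congr fun z => ?_
        rw [ENNReal.tsum_mul_left, ← tauO_neg, neg_sub]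
    -- With `q = z - y` the closed triangle depends on `q` alone, so the sum over `y` can be bounded
    -- uniformly in `q`.
    _ = ∑' y, ∑' q, tauO p (w - (q + y)) * (D (y - v) * (pE p ^ 2 * (B q * tau p q))) := by
        refine tsum_congr fun y => ?_
        rw [← (Equiv.addRight y).tsum_eq]
        exact tsum_congr fun q => by simp
    _ = ∑' q, (∑' y, D (y - v) * tauO p ((w - q) - y)) * (pE p ^ 2 * (B q * tau p q)) := by
        rw [ENNReal.tsum_comm]
        refine tsum_congr fun q => ?_
        rw [← ENNReal.tsum_mul_right]
        refine tsum_congr fun y => ?_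
        rw [sub_sub]
        ring
    _ ≤ ∑' q : Site d, triBBOSup d p * (pE p ^ 2 * (B q * tau p q)) := by
        gcongr with q
        rw [tsum_sub_mul]
        exact le_iSup (triBBO (d := d) p) _
    _ = tri p (0 : Site d) * triBBOSup d p := by
        rw [ENNReal.tsum_mul_left, ENNReal.tsum_mul_left, mul_comm, tri, conv]
        simp_rw [zero_sub, tau_neg, hB]
    _ ≤ _ := by
        gcongr
        exact le_iSup (tri (d := d) p) _

theorem triBO_le (v w : Site d) (h : w ≠ v) : triBO p (w - v) ≤ triBOSup d p :=
  le_iSup₂ (f := fun (x : Site d) (_ : x ≠ 0) => triBO p x) (w - v) (sub_ne_zero.2 h)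

/-- Summing over `t` and `u` gives an open triangle from `y` to `z`, bounded by its supremum. What
is left is `△^{•∘}(w - v)`, whose supremum omits the origin; hence `w ≠ v`. -/
theorem tsum_phiSide_le (v w : Site d) (h : w ≠ v) :
    ∑' z, tauO p (z - w) * ∑' u, pE p * ∑' t, ∑' y, phiSide p v u z t y
      ≤ triSup d p * triBOSup d p := by
  have h1 : ∀ z : Site d, ∑' u, pE p * ∑' t, ∑' y, phiSide p v u z t y =
      ∑' y, pE p * (tauB p (y - v) * tau p (z - y)) * tri p (z - y) := by
    intro z
    calc ∑' u, pE p * ∑' t, ∑' y, phiSide p v u z t y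
        = ∑' u, ∑' y, ∑' t, (pE p ^ 3 * (tauB p (y - v) * tau p (z - y)) * tau p (z - u)) *
            (tau p (t - y) * tau p (u - t)) := by
          refine tsum_congr fun u => ?_
          rw [ENNReal.tsum_comm, ← ENNReal.tsum_mul_left]
          refine tsum_congr fun y => ?_
          rw [← ENNReal.tsum_mul_left]
          refine tsum_congr fun t => ?_
          rw [phiSide, ← tau_neg p (z - u), neg_sub]
          ring
      _ = ∑' y, ∑' u, (pE p ^ 3 * (tauB p (y - v) * tau p (z - y))) *
            (conv (tau p) (tau p) (u - y) * tau p (z - u)) := by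
          rw [ENNReal.tsum_comm]
          simp_rw [ENNReal.tsum_mul_left, tsum_sub_mul]
          refine tsum_congr fun y => ?_
          rw [← tsum_sub_mul, ← ENNReal.tsum_mul_left]
          exact tsum_congr fun u => by ring
      _ = _ := by
          simp_rw [ENNReal.tsum_mul_left, tsum_sub_mul]
          refine tsum_congr fun y => ?_
          rw [tri]
          ring
  simp_rw [h1]
  calc ∑' z, tauO p (z - w) * ∑' y, pE p * (tauB p (y - v) * tau p (z - y)) * tri p (z - y)
      ≤ ∑' z, tauO p (z - w) * ∑' y, pE p * (tauB p (y - v) * tau p (z - y)) * triSup d p := by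
        gcongr with z y
        exact le_iSup (tri (d := d) p) _
    _ = triSup d p * triBO p (w - v) := by
        rw [triBO, conv_right_comm, ← tsum_sub_mul, ← ENNReal.tsum_mul_left,
          ← ENNReal.tsum_mul_left]
        refine tsum_congr fun z => ?_
        rw [ENNReal.tsum_mul_right, ENNReal.tsum_mul_left, tsum_sub_mul, ← tauO_neg, neg_sub]
        ring
    _ ≤ _ := by
        gcongr
        exact triBO_le p v w h

theorem tsum_phi_le (v w : Site d) (h : w ≠ v) :
    ∑' z, tauO p (z - w) * ∑' u, pE p * ∑' t, phi p v u z t ≤ T d p := by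
  simp_rw [phi, ENNReal.tsum_add, mul_add, ENNReal.tsum_add, mul_add, ENNReal.tsum_add]
  rw [tsum_phi_direct]
  calc _ ≤ triBOSup d p + triSup d p * triBBOSup d p + triSup d p * triBOSup d p :=
        add_le_add (add_le_add (triBO_le p v w h) (tsum_phiStem_le p v w)) (tsum_phiSide_le p v w h)
    _ = T d p := by rw [T]; ring

theorem tsum_initial_triangle :
    ∑' u : Site d, pE p * ∑' t, tauB p (t - 0) * tau p (u - t) * tau p (u - 0) = triB p (0 : Site d) := by
  rw [triB, conv, ← ENNReal.tsum_mul_left]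
  refine tsum_congr fun u => ?_
  rw [ENNReal.tsum_mul_right, tsum_sub_mul, zero_sub, tau_neg, sub_zero]

end Triangles

/-! ### Measurability of the events, jointly in the configuration and the set -/

section Measurability

variable {d : ℕ} {Ω : Type*} [MeasurableSpace Ω] {F G : Ω → Set (Site d)}

/-- Paths given as lists of sites form a countable type, so a connection is a countable combination
of membership conditions. -/
theorem measurable_connIn (hF : Measurable F) (x y : Site d) :
    Measurable fun w => ConnIn (F w) x y := by
  simp_rw [connIn_iff]
  refine measurable_const.and (Measurable.exists fun l => measurable_const.and ?_)
  exact Measurable.forall fun s => measurable_const.imp (measurable_set_iff.1 hF s)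

theorem measurable_thick (hF : Measurable F) : Measurable fun w => thick (F w) := by
  refine measurable_set_iff.2 fun a => ?_
  refine (measurable_set_iff.1 hF a).or (Measurable.exists fun x => ?_)
  exact (measurable_set_iff.1 hF x).and measurable_const

theorem measurable_inter_compl (hF : Measurable F) (hG : Measurable G) :
    Measurable fun w => F w ∩ (G w)ᶜ :=
  measurable_set_iff.2 fun a => (measurable_set_iff.1 hF a).and (measurable_set_iff.1 hG a).not

theorem measurable_modCluster (hF : Measurable F) (u x : Site d) :
    Measurable fun w => modCluster u x (F w) := by
  refine measurable_set_iff.2 fun a => ?_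
  refine Measurable.or measurable_const (Measurable.and ?_ ?_)
  · exact (measurable_set_iff.1 hF a).and measurable_const
  · exact measurable_connIn (measurable_inter_compl hF measurable_const) x a

theorem measurable_throughConn (hF : Measurable F) (hG : Measurable G) (x y : Site d) :
    Measurable fun w => F w ∈ throughConn (G w) x y := by
  refine (measurable_connIn hF x y).and (Measurable.or ?_ ?_)
  · exact (measurable_connIn (measurable_inter_compl hF (measurable_thick hG)) x y).not
  · exact measurable_set_iff.1 (measurable_thick hG) y

theorem measurable_piv (hF : Measurable F) (x y a : Site d) :
    Measurable fun w => a ∈ piv (conn x y) (F w) := by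
  refine Measurable.and (measurable_connIn ?_ x y) (measurable_connIn ?_ x y).not
  · exact measurable_set_iff.2 fun s => (measurable_set_iff.1 hF s).or measurable_const
  · exact measurable_set_iff.2 fun s => (measurable_set_iff.1 hF s).and measurable_const

theorem measurable_eventE' (hF : Measurable F) (hG : Measurable G) (v u : Site d) :
    Measurable fun w => F w ∈ eventE' v u (G w) := by
  refine (measurable_throughConn hF hG v u).and (Measurable.not (Measurable.exists fun a => ?_))
  exact (measurable_piv hF v u a).and (measurable_throughConn hF hG v a)

/-- Disjoint occurrence quantifies over uncountably many pairs of sets; finite witnesses make the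
event a countable union. -/
theorem dblConn_eq_up (x y : Site d) : dblConn x y = up (box (cn x y) (cn x y)) := by
  ext ω
  constructor
  · intro h
    obtain ⟨K, L, hK, hL, hKL, hKω, hLω⟩ := exists_disjoint_spath_of_mem_dblConn h
    refine ⟨_, ⟨_, hK.mem_cn, _, hL.mem_cn, ?_, rfl⟩, ?_⟩
    · exact Finset.disjoint_left.2 fun s hs hs' => hKL s (by simpa using hs) (by simpa using hs')
    · intro s hs
      rcases Finset.mem_union.1 hs with hs | hs
      · exact hKω s (by simpa using hs)
      · exact hLω s (by simpa using hs)
  · rintro ⟨_, ⟨K, hK, L, hL, hd, rfl⟩, hω⟩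
    rw [Finset.coe_union, Set.union_subset_iff] at hω
    refine ⟨K, L, by exact_mod_cast hd, fun ω' h => ?_, fun ω' h => ?_⟩
    · exact ConnIn.mono hK fun s hs => (h s hs).2 (hω.1 hs)
    · exact ConnIn.mono hL fun s hs => (h s hs).2 (hω.2 hs)

theorem measurableSet_dblConn (x y : Site d) : MeasurableSet (dblConn x y) := by
  rw [dblConn_eq_up]
  exact measurableSet_up _

end Measurability

/-! ### Peeling off independent configurations -/

section Sequences

variable {d : ℕ} (p : I)

instance : IsProbabilityMeasure (perc d p) := by
  rw [perc]
  infer_instance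

instance : IsProbabilityMeasure (percSeq d p) := by
  rw [percSeq]
  infer_instance

/-- The sequence with first term `q.1` and tail `q.2`. -/
def consSeq (q : Config d × (ℕ → Config d)) : ℕ → Config d
  | 0 => q.1
  | n + 1 => q.2 n

theorem measurable_consSeq : Measurable (consSeq (d := d)) := by
  refine measurable_pi_iff.2 fun n => ?_
  cases n with
  | zero => exact measurable_fst
  | succ n => exact (measurable_pi_apply n).comp measurable_snd

theorem map_consSeq : ((perc d p).prod (percSeq d p)).map consSeq = percSeq d p := by
  classical
  rw [percSeq]
  refine Measure.eq_infinitePi _ fun s t ht => ?_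
  -- Unconstrained coordinates are filled with the whole space, so that products over `s` become
  -- products over an initial segment.
  set t' : ℕ → Set (Config d) := fun i => if i ∈ s then t i else Set.univ with ht'
  have hm : ∀ i, MeasurableSet (t' i) := by
    intro i
    by_cases hi : i ∈ s <;> simp [ht', hi, ht]
  obtain ⟨N, hN⟩ : ∃ N, ∀ i ∈ s, i < N + 1 := ⟨s.sup id, fun i hi =>
    Nat.lt_succ_of_le (Finset.le_sup (f := id) hi)⟩
  have hpre : consSeq (d := d) ⁻¹' Set.pi s t =
      t' 0 ×ˢ Set.pi (Finset.range N) (fun i => t' (i + 1)) := by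
    ext ⟨a, f⟩
    simp only [Set.mem_preimage, Set.mem_pi, Set.mem_prod, SetLike.mem_coe, Finset.mem_range]
    constructor
    · intro h
      refine ⟨?_, fun i _ => ?_⟩
      · by_cases h0 : 0 ∈ s
        · simpa [ht', h0, consSeq] using h 0 h0
        · simp [ht', h0]
      · by_cases h0 : i + 1 ∈ s
        · simpa [ht', h0, consSeq] using h (i + 1) h0
        · simp [ht', h0]
    · rintro ⟨h0, h1⟩ i hi
      cases i with
      | zero => simpa [ht', hi, consSeq] using h0
      | succ i => simpa [ht', hi, consSeq] using h1 i (by have := hN _ hi; omega)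
  rw [Measure.map_apply measurable_consSeq (.pi s.countable_toSet fun i _ => ht i), hpre,
    Measure.prod_prod, Measure.infinitePi_pi _ fun i _ => hm (i + 1), mul_comm, perc]
  rw [← Finset.prod_range_succ' (fun i => setBernoulli Set.univ p (t' i))]
  refine (Finset.prod_subset_one_on_sdiff (fun i hi => Finset.mem_range.2 (hN i hi)) ?_ ?_).symm
  · intro i hi
    simp [ht', (Finset.mem_sdiff.1 hi).2]
  · intro i hi
    simp [ht', hi]

theorem percSeq_eq_lintegral {E : Set (Config d)} (hE : MeasurableSet E)
    {G : Config d → Set (ℕ → Config d)}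
    (hG : MeasurableSet {q : Config d × (ℕ → Config d) | q.2 ∈ G q.1}) :
    percSeq d p {f | f 0 ∈ E ∧ (fun n => f (n + 1)) ∈ G (f 0)} =
      ∫⁻ ω in E, percSeq d p (G ω) ∂(perc d p) := by
  have hsplit : Measurable fun f : ℕ → Config d => (f 0, fun n => f (n + 1)) :=
    (measurable_pi_apply 0).prodMk (measurable_pi_iff.2 fun n => measurable_pi_apply (n + 1))
  have hS : MeasurableSet {f : ℕ → Config d | f 0 ∈ E ∧ (fun n => f (n + 1)) ∈ G (f 0)} :=
    ((measurable_pi_apply 0) hE).inter (hsplit hG)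
  have hmeas : MeasurableSet {q : Config d × (ℕ → Config d) | q.1 ∈ E ∧ q.2 ∈ G q.1} :=
    (measurable_fst hE).inter hG
  conv_lhs => rw [← map_consSeq, Measure.map_apply measurable_consSeq hS]
  change (perc d p).prod (percSeq d p) {q | q.1 ∈ E ∧ q.2 ∈ G q.1} = _
  rw [Measure.prod_apply hmeas, ← lintegral_indicator hE]
  refine lintegral_congr fun ω => ?_
  by_cases hω : ω ∈ E
  · simp only [hω, Set.indicator_of_mem]
    congr 1
    ext f
    simp [hω]
  · simp [hω]

/-- The event that `E'(a_j, a_{j+1}; A_j)` occurs in the `j`-th configuration for `j < k`, where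
`A_0 = A` and `A_{j+1}` is the modified cluster of `a_j` with designated vertex `a_{j+1}`. -/
def chainEvent : ℕ → (ℕ → Site d) → Set (Site d) → Set (ℕ → Config d)
  | 0, _, _ => Set.univ
  | k + 1, a, A => {f | f 0 ∈ eventE' (a 0) (a 1) A ∧
      (fun n => f (n + 1)) ∈ chainEvent k (fun n => a (n + 1)) (modCluster (a 1) (a 0) (f 0))}

theorem measurable_chainEvent {Ω : Type*} [MeasurableSpace Ω] (k : ℕ) (a : ℕ → Site d)
    {F : Ω → ℕ → Config d} {G : Ω → Set (Site d)} (hF : Measurable F) (hG : Measurable G) :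
    Measurable fun w => F w ∈ chainEvent k a (G w) := by
  induction k generalizing a F G with
  | zero => exact measurable_const
  | succ k ih =>
    have h0 : Measurable fun w => F w 0 := measurable_pi_iff.1 hF 0
    refine (measurable_eventE' h0 hG _ _).and (ih _ ?_ (measurable_modCluster h0 _ _))
    exact measurable_pi_iff.2 fun n => measurable_pi_iff.1 hF (n + 1)

theorem measurableSet_chainEvent (k : ℕ) (a : ℕ → Site d) (u v : Site d) :
    MeasurableSet {q : Config d × (ℕ → Config d) | q.2 ∈ chainEvent k a (modCluster u v q.1)} :=
  measurableSet_setOfPred.2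
    (measurable_chainEvent k a measurable_snd (measurable_modCluster measurable_fst u v))

theorem chainEvent_congr (k : ℕ) {a a' : ℕ → Site d} (h : ∀ j ≤ k, a j = a' j)
    (A : Set (Site d)) : chainEvent k a A = chainEvent k a' A := by
  induction k generalizing a a' A with
  | zero => rfl
  | succ k ih =>
    simp only [chainEvent]
    rw [h 0 (by omega), h 1 (by omega)]
    ext f
    rw [Set.mem_ofPred_eq, Set.mem_ofPred_eq, ih fun j hj => h (j + 1) (by omega)]

theorem mem_chainEvent_iff (k : ℕ) (a : ℕ → Site d) (f : ℕ → Config d) :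
    (fun n => f (n + 1)) ∈ chainEvent k (fun n => a (n + 1)) (modCluster (a 1) (a 0) (f 0)) ↔
      ∀ j < k, f (j + 1) ∈ eventE' (a (j + 1)) (a (j + 2))
        (modCluster (a (j + 1)) (a j) (f j)) := by
  induction k generalizing a f with
  | zero => simp [chainEvent]
  | succ k ih =>
    rw [Nat.forall_lt_succ_left']
    exact and_congr Iff.rfl (ih (fun n => a (n + 1)) (fun n => f (n + 1)))

/-- The sequence `v, q_0, …, q_{k-1}, 0, 0, …`. -/
def extend {k : ℕ} (v : Site d) (q : Fin k → Site d) : ℕ → Site d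
  | 0 => v
  | j + 1 => if h : j < k then q ⟨j, h⟩ else 0

theorem extend_cons_succ {k : ℕ} (v u : Site d) (q : Fin k → Site d) :
    (fun n => extend v (Fin.cons u q : Fin (k + 1) → Site d) (n + 1)) = extend u q := by
  funext n
  cases n with
  | zero => simp [extend]
  | succ n =>
    by_cases hn : n < k
    · simp only [extend, hn, Nat.add_lt_add_iff_right, dif_pos]
      exact Fin.cons_succ (α := fun _ => Site d) u q ⟨n, hn⟩
    · simp [extend, hn]

/-- The coefficient singles out the last site `x`, while the recursion singles out the first site
`u₀`; both list the same `m + 1` sites. -/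
theorem laceEvent_eq {m : ℕ} (u₀ : Site d) (q : Fin m → Site d) {u : Fin m → Site d} {x : Site d}
    (h : (Fin.cons u₀ q : Fin (m + 1) → Site d) = Fin.snoc u x) :
    laceEvent u x = {f | f 0 ∈ dblConn 0 u₀ ∧
      (fun n => f (n + 1)) ∈ chainEvent m (extend u₀ q) (modCluster u₀ 0 (f 0))} := by
  have hv : ∀ j ≤ m, vtx u x (j + 1) = extend u₀ q j := by
    intro j hj
    rw [← extend_cons_succ 0, h]
    rcases hj.lt_or_eq with hj | rfl
    · simp [vtx, extend, hj, hj.le, Fin.snoc]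
    · simp [vtx, extend, Fin.snoc]
  have h1 : vtx u x 1 = u₀ := hv 0 (by omega)
  ext f
  refine and_congr (by rw [h1]) ?_
  rw [← mem_chainEvent_iff m (vtx u x) f, chainEvent_congr m hv, h1]
  rfl

/-! ### Recursion over the steps of the lace expansion -/

/-- The bound on `k` steps of the lace expansion started at `v` and attached at `z`. -/
noncomputable def laceBound : ℕ → Site d → Site d → ℝ≥0∞
  | 0, v, z => if z = v then 1 else 0
  | k + 1, v, z => ∑' u, pE p * ∑' t, if t ≠ u then
      phi p v u z t * ∑' b, tauO p (b - t) * laceBound k u b else 0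

/-- Each step costs a factor `T` because its entry point differs from the preceding branch point;
the condition `t ≠ u` inside `laceBound` passes this on. For `k = 0` it reduces `τ^∘` to `τ ≤ 1`. -/
theorem tsum_tauO_mul_laceBound_le (k : ℕ) {t u : Site d} (h : t ≠ u) :
    ∑' b, tauO p (b - t) * laceBound p k u b ≤ T d p ^ k := by
  induction k generalizing t u with
  | zero =>
    rw [tsum_eq_single u]
    · simpa [laceBound, tauO, sub_eq_zero, h.symm] using tau_le_one p (u - t)
    · intro b hb
      simp [laceBound, hb]
  | succ k ih =>
    calc ∑' z, tauO p (z - t) * laceBound p (k + 1) u z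
        ≤ ∑' z, tauO p (z - t) * ∑' u', pE p * ∑' t', phi p u u' z t' * T d p ^ k := by
          simp only [laceBound]
          gcongr with z u' t'
          split_ifs with ht'
          · gcongr
            exact ih ht'
          · exact zero_le
      _ = (∑' z, tauO p (z - t) * ∑' u', pE p * ∑' t', phi p u u' z t') * T d p ^ k := by
          simp_rw [ENNReal.tsum_mul_right, ← mul_assoc, ENNReal.tsum_mul_right, ← mul_assoc,
            ENNReal.tsum_mul_right]
      _ ≤ T d p ^ (k + 1) := by
          rw [pow_succ']
          gcongr
          exact tsum_phi_le p u t h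

/-- The total weight of `k` steps of the lace expansion from `v` with the set `A`. -/
noncomputable def chainSum (k : ℕ) (v : Site d) (A : Set (Site d)) : ℝ≥0∞ :=
  pE p ^ k * ∑' q : Fin k → Site d, percSeq d p (chainEvent k (extend v q) A)

-- The bound on the later steps is linear in the indicators of `b ∈ ⟨C⟩`, so it can be integrated
-- term by term although the random cluster `C` is the set used in the next step.
open Classical in
theorem lintegral_chainSum_le {k : ℕ} {u v : Site d}
    (hk : ∀ A, u ∈ thick A → chainSum p k u A ≤ ∑' z, if z ∈ thick A then laceBound p k u z else 0)
    {E : Set (Config d)} (hE : MeasurableSet E) (hEc : E ⊆ conn v u) :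
    ∫⁻ ω in E, chainSum p k u (modCluster u v ω) ∂(perc d p) ≤
      ∑' b, perc d p (E ∩ {ω | b ∈ thick (modCluster u v ω)}) * laceBound p k u b := by
  have hm : ∀ b : Site d, MeasurableSet {ω : Config d | b ∈ thick (modCluster u v ω)} := fun b =>
    measurableSet_setOfPred.2
      (measurable_set_iff.1 (measurable_thick (measurable_modCluster measurable_id u v)) b)
  calc ∫⁻ ω in E, chainSum p k u (modCluster u v ω) ∂(perc d p)
      ≤ ∫⁻ ω in E, ∑' b, {ω : Config d | b ∈ thick (modCluster u v ω)}.indicator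
          (fun _ => laceBound p k u b) ω ∂(perc d p) := by
        refine setLIntegral_mono' hE fun ω hω => (hk _ (mem_thick_modCluster_self (hEc hω))).trans ?_
        simp only [Set.indicator_apply, Set.mem_ofPred_eq]
        exact le_rfl
    _ = ∑' b, perc d p (E ∩ {ω | b ∈ thick (modCluster u v ω)}) * laceBound p k u b := by
        rw [lintegral_tsum fun b => (measurable_const.indicator (hm b)).aemeasurable]
        refine tsum_congr fun b => ?_
        rw [lintegral_indicator (hm b), setLIntegral_const, Measure.restrict_apply (hm b),
          Set.inter_comm, mul_comm]

/-- Peeling off the first configuration. -/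
theorem tsum_percSeq_eq_lintegral (k : ℕ) (u v : Site d) {E : Set (Config d)}
    (hE : MeasurableSet E) :
    pE p ^ k * ∑' q : Fin k → Site d, percSeq d p {f | f 0 ∈ E ∧
      (fun n => f (n + 1)) ∈ chainEvent k (extend u q) (modCluster u v (f 0))} =
      ∫⁻ ω in E, chainSum p k u (modCluster u v ω) ∂(perc d p) := by
  have hmeas : ∀ q : Fin k → Site d, Measurable fun ω : Config d =>
      percSeq d p (chainEvent k (extend u q) (modCluster u v ω)) := fun q =>
    measurable_measure_prodMk_left (measurableSet_chainEvent k (extend u q) u v)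
  simp only [chainSum]
  rw [lintegral_const_mul _ (Measurable.tsum hmeas),
    lintegral_tsum fun q => (hmeas q).aemeasurable]
  congr 1
  exact tsum_congr fun q => percSeq_eq_lintegral p hE
    (G := fun ω => chainEvent k (extend u q) (modCluster u v ω)) (measurableSet_chainEvent k _ u v)

theorem tsum_fin_succ (k : ℕ) (F : (Fin (k + 1) → Site d) → ℝ≥0∞) :
    ∑' q, F q = ∑' u, ∑' q : Fin k → Site d, F (Fin.cons u q) := by
  rw [← (Fin.consEquiv fun _ : Fin (k + 1) => Site d).tsum_eq, ENNReal.tsum_prod']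
  rfl

theorem tsum_fin_succ_last (k : ℕ) (F : (Fin (k + 1) → Site d) → ℝ≥0∞) :
    ∑' q, F q = ∑' x, ∑' q : Fin k → Site d, F (Fin.snoc q x) := by
  rw [← (Fin.snocEquiv fun _ : Fin (k + 1) => Site d).tsum_eq, ENNReal.tsum_prod']
  rfl

theorem measurableSet_eventE' (v u : Site d) (A : Set (Site d)) :
    MeasurableSet (eventE' v u A) :=
  measurableSet_setOfPred.2 (measurable_eventE' measurable_id measurable_const v u)

-- Induction on the number of steps: integrate over the first configuration and apply the hypothesis
-- with its cluster as the new set. For `k = 0` the term `z = v` suffices, by `hv`.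
open Classical in
theorem chainSum_le (k : ℕ) (v : Site d) (A : Set (Site d)) (hv : v ∈ thick A) :
    chainSum p k v A ≤ ∑' z, if z ∈ thick A then laceBound p k v z else 0 := by
  induction k generalizing v A with
  | zero =>
    refine le_trans ?_ (ENNReal.le_tsum v)
    simp [chainSum, chainEvent, laceBound, hv]
  | succ k ih =>
    calc chainSum p (k + 1) v A
        = ∑' u, pE p * ∫⁻ ω in eventE' v u A, chainSum p k u (modCluster u v ω) ∂(perc d p) := by
          rw [chainSum, tsum_fin_succ, ← ENNReal.tsum_mul_left]
          refine tsum_congr fun u => ?_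
          rw [← tsum_percSeq_eq_lintegral p k u v (measurableSet_eventE' v u A), pow_succ',
            mul_assoc]
          congr 3
          funext q
          simp only [chainEvent, extend_cons_succ]
          rfl
      _ ≤ ∑' u, pE p * ∑' b, (∑' z, if z ∈ thick A then
            ∑' t, if t ≠ u then phi p v u z t * tauO p (b - t) else 0 else 0) *
              laceBound p k u b := by
          gcongr with u
          refine (lintegral_chainSum_le p (ih u) (measurableSet_eventE' v u A)
            fun ω hω => hω.1.1).trans ?_
          gcongr with b
          exact perc_eventE'_inter_le p v u b A
      _ = ∑' z, if z ∈ thick A then laceBound p (k + 1) v z else 0 := by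
          have h1 : ∀ u : Site d, ∑' b, (∑' z, if z ∈ thick A then
              ∑' t, if t ≠ u then phi p v u z t * tauO p (b - t) else 0 else 0) *
                laceBound p k u b = ∑' z, if z ∈ thick A then ∑' t, if t ≠ u then
                  phi p v u z t * ∑' b, tauO p (b - t) * laceBound p k u b else 0 else 0 := by
            intro u
            simp_rw [← ENNReal.tsum_mul_right]
            rw [ENNReal.tsum_comm]
            refine tsum_congr fun z => ?_
            split_ifs
            · simp_rw [← ENNReal.tsum_mul_right]
              rw [ENNReal.tsum_comm]
              refine tsum_congr fun t => ?_
              split_ifs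
              · rw [← ENNReal.tsum_mul_left]
                exact tsum_congr fun b => mul_assoc _ _ _
              · simp
            · simp
          simp_rw [h1, ← ENNReal.tsum_mul_left]
          rw [ENNReal.tsum_comm]
          refine tsum_congr fun z => ?_
          split_ifs
          · rw [laceBound]
            simp_rw [ENNReal.tsum_mul_left]
          · simp

theorem tsum_lintegral_dblConn_le (n : ℕ) :
    ∑' u, pE p * ∫⁻ ω in dblConn 0 u, chainSum p n u (modCluster u 0 ω) ∂(perc d p) ≤
      triB p (0 : Site d) * T d p ^ n := by
  classical
  calc ∑' u, pE p * ∫⁻ ω in dblConn 0 u, chainSum p n u (modCluster u 0 ω) ∂(perc d p)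
      ≤ ∑' u : Site d, pE p * ∑' b, (∑' t, if t ≠ u then
          tauB p (t - 0) * tau p (u - t) * tau p (u - 0) * tauO p (b - t) else 0) *
            laceBound p n u b := by
        gcongr with u
        refine (lintegral_chainSum_le p (chainSum_le p n u) (measurableSet_dblConn 0 u)
          fun ω hω => ?_).trans ?_
        · obtain ⟨K, -, hK, -, -, hKω, -⟩ := exists_disjoint_spath_of_mem_dblConn hω
          exact hK.connIn hKω
        · gcongr with b
          exact perc_dblConn_inter_le p 0 u b
    _ = ∑' u : Site d, pE p * ∑' t, if t ≠ u then
          tauB p (t - 0) * tau p (u - t) * tau p (u - 0) *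
            ∑' b, tauO p (b - t) * laceBound p n u b else 0 := by
        refine tsum_congr fun u => ?_
        simp_rw [← ENNReal.tsum_mul_right]
        rw [ENNReal.tsum_comm]
        congr 1
        refine tsum_congr fun t => ?_
        split_ifs
        · rw [← ENNReal.tsum_mul_left]
          exact tsum_congr fun b => mul_assoc _ _ _
        · simp
    _ ≤ ∑' u : Site d, pE p * ∑' t,
          tauB p (t - 0) * tau p (u - t) * tau p (u - 0) * T d p ^ n := by
        gcongr with u t
        split_ifs with h
        · gcongr
          exact tsum_tauO_mul_laceBound_le p n h
        · exact zero_le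
    _ = triB p (0 : Site d) * T d p ^ n := by
        rw [← tsum_initial_triangle, ← ENNReal.tsum_mul_right]
        refine tsum_congr fun u => ?_
        rw [ENNReal.tsum_mul_right, mul_assoc]

/-- The extra factor `p` on the left makes one factor for each of the `m + 2` sites `u₀, …, u_m, x`;
on the right the factor of `u₀` is in front and the others are in `chainSum`. -/
theorem tsum_lacePi_succ (m : ℕ) :
    pE p * ∑' x : Site d, lacePi p (m + 1) x =
      ∑' u, pE p * ∫⁻ ω in dblConn 0 u, chainSum p (m + 1) u (modCluster u 0 ω) ∂(perc d p) := by
  simp only [lacePi]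
  rw [ENNReal.tsum_mul_left, ENNReal.tsum_mul_left]
  simp_rw [← tsum_percSeq_eq_lintegral p (m + 1) _ 0 (measurableSet_dblConn 0 _)]
  rw [ENNReal.tsum_mul_left]
  congr 2
  set F : (Fin (m + 2) → Site d) → ℝ≥0∞ := fun q =>
    percSeq d p (laceEvent (Fin.init q : Fin (m + 1) → Site d) (q (Fin.last _)))
  trans ∑' q, F q
  · rw [tsum_fin_succ_last]
    simp [F]
  · rw [tsum_fin_succ]
    refine tsum_congr fun u => tsum_congr fun q => ?_
    simp only [F]
    rw [laceEvent_eq u q]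
    exact (Fin.snoc_init_self _).symm

theorem chainSum_zero (v : Site d) (A : Set (Site d)) : chainSum p 0 v A = 1 := by
  simp [chainSum, chainEvent]

end Sequences

end SitePerc

theorem proposition3 (d : ℕ) (p : unitInterval) (n : ℕ) :
    SitePerc.pE p * ∑' x : SitePerc.Site d, SitePerc.lacePi p n x
      ≤ SitePerc.triB p (0 : SitePerc.Site d) * SitePerc.T d p ^ n := by
  refine le_trans ?_ (SitePerc.tsum_lintegral_dblConn_le p n)
  cases n with
  | zero =>
    rw [← ENNReal.tsum_mul_left]
    refine ENNReal.tsum_le_tsum fun x => ?_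
    -- For `n = 0` there are no further steps, and the subtracted `J` is simply dropped.
    simp only [SitePerc.chainSum_zero, lintegral_const, Measure.restrict_apply_univ, one_mul]
    gcongr
    exact tsub_le_self
  | succ m => exact (SitePerc.tsum_lacePi_succ p m).le
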